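/- **Conventions.** Sequences are finite ordered sequences of positive integers; a *side* of a sequence is a pair $(a,b)$ of adjacent members, in order. *Inserting $a\oplus b$* into a side $(a,b)$ means replacing $\ldots,a,b,\ldots$ by $\ldots,a,a+b,b,\ldots$. A *Farey sequence* is a sequence obtained from $\{1,1\}$ by finitely many such insertions. $F_r$ denotes the ordered sequence of the denominators of the rationals in $[0,1]$ with denominator at most $r$ (it arises from $\{1,1\}$ by inserting $a\oplus b$ into sides with $a+b\le r$ until no such side is left). Fix $N\ge 1$. Pairs $(a,b)$ and $(x,y)$ are *paired* if $N\mid ax+by$; $(a,b)$ is *elliptic* if $N\mid a^2+b^2$ or $N\mid a^2+ab+b^2$; a side of a sequence $D$ is *free* in $D$ if it is not elliptic and not paired with any side of $D$. Let $\Gamma=PSL(2,\mathbb Z)$ and let $\Gamma_0(N)\le\Gamma$ be the subgroup of (classes of) matrices with $(2,1)$-entry divisible by $N$. A *Farey sequence of $\Gamma_0(N)$* is a Farey sequence $F$ that is obtained from $F_{\lfloor\sqrt N\rfloor}$ by insertions, has exactly $1+\lfloor[\Gamma:\Gamma_0(N)]/3\rfloor$ members, and in which every non-elliptic side is paired with exactly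 one side of $F$. **Algorithm [DKLT].** Let $n\ge 2$, $N=2^n$ and $r=\lfloor 2^{n/2}\rfloor$. 1. Construct $F_r$. 2. List, in any order, the free sides $s_1,\dots,s_k$ of $F_r$ of the form $(a,b)$ with $a$ odd and $b$ even. 3. For each $s_i=(a,b)$, one after the other: find the least integer $v\ge 1$ such that $(a+vb,b)$ is paired with some side $(x,y)$ of $F_r$; put $v_1=\lceil v/2\rceil$, $v_2=\lfloor v/2\rfloor$; insert $a+b,a+2b,\dots,a+v_1b$ (in this order) into the side $(a,b)$, and $y+v_2x,\dots,y+2x,y+x$ (in this order) into the side $(x,y)$. The sequence reached after $s_1,\dots,s_k$ is $S_1$. 4. Insert $a\oplus b$ into every side $(a,b)$ of $S_1$ with $a,b$ both odd and $2^{\lceil n/2\rceil}\mid a+b$. The result is $T$. **Theorem 9.1.** Let $n\ge 2$. For every ordering of the free sides in step 2, all steps of the algorithm can be carried out (the integer $v$ of step 3 always exists), and the resulting sequence $T$ is a Farey sequence of $\Gamma_0(2^n)$. All members of $T$ are at most $2^{n-1}$, and exactly one member of $T$ equals $2^{n-1}$. The bound $2^{n-1}$ is optimal: every Farey sequence of $\Gamma_0(2^n)$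 has a member that is at least $2^{n-1}$. -/

import Mathlib

namespace DKLT

/-- The sides of an ordered sequence: its pairs of adjacent members, from left to right. -/
def sides (L : List ℕ) : List (ℕ × ℕ) := L.zip L.tail

/-- The sequence `L'` arises from `L` by inserting `a + b` into one side `(a, b)`. -/
inductive InsertStep : List ℕ → List ℕ → Prop
  | mk (u w : List ℕ) (a b : ℕ) : InsertStep (u ++ a :: b :: w) (u ++ a :: (a + b) :: b :: w)

/-- `L'` refines `L`: it arises from `L` by finitely many such insertions. -/
def Refines (L L' : List ℕ) : Prop := Relation.ReflTransGen InsertStep L L'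

/-- A Farey sequence (of denominators): a sequence obtained from `{1, 1}` by insertions. -/
def IsFareySequence (L : List ℕ) : Prop := Refines [1, 1] L

/-- Insert `a + b` into each side `(a, b)` of the sequence that satisfies `P`. -/
def insertWhere (P : ℕ → ℕ → Prop) [∀ a b, Decidable (P a b)] : List ℕ → List ℕ
  | [] => []
  | [a] => [a]
  | a :: b :: l =>
    if P a b then a :: (a + b) :: insertWhere P (b :: l) else a :: insertWhere P (b :: l)

/-- `F_r`, the ordered denominators of the Farey sequence of order `r` (the rationals in `[0, 1]`
with denominator at most `r`), by the Farey construction: start from `{1, 1}` and insert `a + b`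
into sides `(a, b)` as long as `a + b ≤ r`, here in the order of increasing `a + b`. -/
def fareyF : ℕ → List ℕ
  | 0 => [1, 1]
  | k + 1 => insertWhere (fun a b => a + b = k + 1) (fareyF k)

/-- Elliptic (even or odd) sides with respect to `N`. -/
abbrev IsElliptic (N : ℕ) (s : ℕ × ℕ) : Prop :=
  N ∣ s.1 ^ 2 + s.2 ^ 2 ∨ N ∣ s.1 ^ 2 + s.1 * s.2 + s.2 ^ 2

/-- The pairs `(a, b)` and `(x, y)` are paired with respect to `N`. -/
abbrev IsPaired (N : ℕ) (s t : ℕ × ℕ) : Prop := N ∣ s.1 * t.1 + s.2 * t.2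

/-- `s` is free in the sequence `L`: not elliptic and not paired with any side of `L`. -/
abbrev IsFree (N : ℕ) (L : List ℕ) (s : ℕ × ℕ) : Prop :=
  ¬ IsElliptic N s ∧ ∀ t ∈ sides L, ¬ IsPaired N s t

/-- The group `PSL(2, ℤ)`. -/
abbrev Modular : Type := Matrix.ProjectiveSpecialLinearGroup (Fin 2) ℤ

/-- The group `Γ₀(N)` as a subgroup of `PSL(2, ℤ)`. -/
def gammaZero (N : ℕ) : Subgroup Modular :=
  (CongruenceSubgroup.Gamma0 N).map
    (QuotientGroup.mk' (Subgroup.center (Matrix.SpecialLinearGroup (Fin 2) ℤ)))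

/-- Farey sequences of `Γ₀(N)`: Farey sequences that refine `F_r`, `r = ⌊√N⌋`, have
`1 + ⌊[PSL(2, ℤ) : Γ₀(N)] / 3⌋` members, and in which every non-elliptic side is paired
with exactly one side. -/
structure IsFareySequenceOf (N : ℕ) (L : List ℕ) : Prop where
  isFareySequence : IsFareySequence L
  refines : Refines (fareyF (Nat.sqrt N)) L
  length_eq : L.length = 1 + (gammaZero N).index / 3
  paired : ∀ s ∈ sides L, ¬ IsElliptic N s → ∃! t : ℕ × ℕ, t ∈ sides L ∧ IsPaired N s t

/-- The free sides `(a, b)` of `F_r`, `r = ⌊2 ^ (n / 2)⌋`, with `a` odd and `b` even. -/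
def freeEvenSides (n : ℕ) : List (ℕ × ℕ) :=
  (sides (fareyF (Nat.sqrt (2 ^ n)))).filter fun s =>
    decide (Odd s.1 ∧ Even s.2 ∧ IsFree (2 ^ n) (fareyF (Nat.sqrt (2 ^ n))) s)

/-- For `s = (a, b)`, search for the least `v ≥ 1` such that `(a + v b, b)` is paired with a
side `(x, y)` of `F`, and return `v` and `(x, y)`. (Whether `v` has this property depends only
on `v` modulo `N`, so it is enough to try `v = 1, …, N`.) -/
def chainSearch (N : ℕ) (F : List ℕ) (s : ℕ × ℕ) : Option (ℕ × (ℕ × ℕ)) :=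
  (List.range' 1 N).findSome? fun v =>
    ((sides F).find? fun t => decide (IsPaired N (s.1 + v * s.2, s.2) t)).map fun t => (v, t)

/-- Insert the members of `m`, in order, into the side `s`. -/
def insertInSide (s : ℕ × ℕ) (m : List ℕ) : List ℕ → List ℕ
  | [] => []
  | [a] => [a]
  | a :: b :: l =>
    if (a, b) = s then a :: (m ++ insertInSide s m (b :: l)) else a :: insertInSide s m (b :: l)

/-- Insert into the sequence `L` the interior members of the chain of `s = (a, b)`, which is
`{a, a + b, …, a + v₁ b, b} ∪ {x, y + v₂ x, …, y + x, y}` with `v₁ = ⌈v / 2⌉` and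
`v₂ = ⌊v / 2⌋`, where `v` and `(x, y)` are found by searching in `F`. The result is `none` if
the search fails. -/
def insertChain (N : ℕ) (F L : List ℕ) (s : ℕ × ℕ) : Option (List ℕ) :=
  (chainSearch N F s).map fun r =>
    insertInSide s ((List.range' 1 ((r.1 + 1) / 2)).map fun k => s.1 + k * s.2)
      (insertInSide r.2 ((List.range' 1 (r.1 / 2)).map fun k => r.2.2 + k * r.2.1).reverse L)

/-- The algorithm [DKLT] for `Γ₀(2 ^ n)`: build `F_r`; insert, one by one, the chains of the sides
in the list `order`, which gives `S₁`; then insert `a + b` into every side `(a, b)` of `S₁` with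
`a`, `b` odd and `a + b` a multiple of `2 ^ ⌈n / 2⌉`. The list `order` is meant to be a list of
all free sides of `F_r` with odd first and even second entry. The value is `none` if some
chain cannot be constructed. -/
def algorithm (n : ℕ) (order : List (ℕ × ℕ)) : Option (List ℕ) :=
  (order.foldlM (insertChain (2 ^ n) (fareyF (Nat.sqrt (2 ^ n))))
      (fareyF (Nat.sqrt (2 ^ n)))).map
    (insertWhere fun a b => Odd a ∧ Odd b ∧ 2 ^ ((n + 1) / 2) ∣ a + b)

end DKLT

/-! A Farey sequence is an ideal polygon cut into triangles of the Farey tessellation. Splitting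
`(a, b)` attaches the triangle with denominators `a`, `a + b`, `b`; the pair `(1, 0)` stands for the
top triangle `1`, `1`, `0`. So a sequence is encoded by the set `I` of its triangles and has
`I.ncard + 1` members. With signs chosen so that they sum to zero, the denominators of a triangle
contain exactly one even entry. Its quotient by the next entry in cyclic order is an even residue
modulo `2 ^ n`, the invariant `cls` of the triangle under Γ₀(2^n). There are `2 ^ (n - 1)` such
residues, a third of the index. Two sides are paired when the triangle outside one is equivalent to
the triangle inside the other, with matching parities (`isPaired_iff`). Hence the goal is a polygon
with one triangle from each class; by `Triangulates.isFareySequenceOf`, distinct classes and closure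
under a few moves across edges suffice. Triangles of `F_r` are inequivalent because the cross
products comparing them stay below `r * r ≤ 2 ^ n`. Above a free side `(a, b)` with `b` even, the
triangles around the vertex `b` form a fan, followed until it runs into a class of `F_r`. Walking
two fans backwards shows that they share no class (`fan_injective`). A short lattice vector bounds
the length of a fan (`exists_hits_lt`), and attaching half of it at each end keeps the entries
small. The last triangles lie below odd sides with `2 ^ ⌈n/2⌉ ∣ a + b`; rotation about their even
vertex fixes their class, since `2 ^ n ∣ (a + b) ^ 2`. For optimality, closure under rotation and
flip forces the class of `2 ^ (n - 1)` to occur (`frac_half_mem`), and a triangle of that class has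
an even denominator that is an odd multiple of `2 ^ (n - 1)`. -/

namespace DKLT

/-! ### Farey sequences as sets of triangles -/

/-- The parent of a node of the Stern–Brocot tree of pairs; the root `(1, 1)` has parent `(1, 0)`. -/
def parent (s : ℕ × ℕ) : ℕ × ℕ := if s.1 ≤ s.2 then (s.1, s.2 - s.1) else (s.1 - s.2, s.2)

/-- `L` is a Farey sequence and `I` is the set of pairs that were split in its construction,
together with `(1, 0)`. -/
inductive Triangulates : List ℕ → Set (ℕ × ℕ) → Prop
  | base : Triangulates [1, 1] {(1, 0)}
  | step (u w : List ℕ) (a b : ℕ) (I : Set (ℕ × ℕ)) (h : Triangulates (u ++ a :: b :: w) I) :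
      Triangulates (u ++ a :: (a + b) :: b :: w) (insert (a, b) I)

theorem sides_cons_cons (a b : ℕ) (l : List ℕ) : sides (a :: b :: l) = (a, b) :: sides (b :: l) :=
  rfl

theorem sides_append (u : List ℕ) (a : ℕ) (w : List ℕ) :
    sides (u ++ a :: w) = sides (u ++ [a]) ++ sides (a :: w) := by
  induction u with
  | nil => simp [sides]
  | cons c u ih =>
    cases u with
    | nil => simp [sides]
    | cons d u =>
      simp only [List.cons_append, sides_cons_cons] at ih ⊢
      rw [ih]

theorem sides_split (u : List ℕ) (a b : ℕ) (w : List ℕ) :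
    sides (u ++ a :: b :: w) = sides (u ++ [a]) ++ (a, b) :: sides (b :: w) := by
  rw [sides_append, sides_cons_cons]

theorem parent_left {a b : ℕ} : parent (a, a + b) = (a, b) := by
  simp [parent]

theorem parent_right {a b : ℕ} (ha : 1 ≤ a) : parent (a + b, b) = (a, b) := by
  simp only [parent]
  rw [if_neg (by omega)]
  simp

theorem eq_of_parent {s : ℕ × ℕ} {a b : ℕ} (h : parent s = (a, b)) :
    s = (a, a + b) ∨ s = (a + b, b) := by
  obtain ⟨x, y⟩ := s
  simp only [parent] at h
  split_ifs at h with hxy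
  · left
    simp only [Prod.mk.injEq] at h ⊢
    omega
  · right
    simp only [Prod.mk.injEq] at h ⊢
    omega

theorem coprime_parent {s : ℕ × ℕ} (h : Nat.Coprime s.1 s.2) :
    Nat.Coprime (parent s).1 (parent s).2 := by
  obtain ⟨x, y⟩ := s
  simp only [parent] at h ⊢
  split_ifs with hxy
  · exact (Nat.coprime_sub_self_right hxy).mpr h
  · exact (Nat.coprime_sub_self_left (by omega)).mpr h

theorem coprime_of_parent {s : ℕ × ℕ} (h : Nat.Coprime (parent s).1 (parent s).2) :
    Nat.Coprime s.1 s.2 := by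
  obtain ⟨x, y⟩ := s
  simp only [parent] at h ⊢
  split_ifs at h with hxy
  · exact (Nat.coprime_sub_self_right hxy).mp h
  · exact (Nat.coprime_sub_self_left (by omega)).mp h

namespace Triangulates

variable {L : List ℕ} {I : Set (ℕ × ℕ)}

theorem isFareySequence (h : Triangulates L I) : IsFareySequence L := by
  induction h with
  | base => exact Relation.ReflTransGen.refl
  | step u w a b I _ ih => exact ih.tail (InsertStep.mk u w a b)

theorem base_mem (h : Triangulates L I) : (1, 0) ∈ I := by
  induction h with
  | base => rfl
  | step u w a b I _ ih => exact Or.inr ih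

theorem finite (h : Triangulates L I) : I.Finite := by
  induction h with
  | base => exact Set.finite_singleton _
  | step u w a b I _ ih => exact ih.insert _

/-- The split pairs form a finite subtree for `parent`, and the sides are the nodes just outside it.
Thus `I` alone determines which pairs are sides, whatever the order of the insertions. -/
theorem sides_aux (h : Triangulates L I) : (sides L).Nodup ∧
    (∀ s, s ∈ sides L ↔ s ∉ I ∧ 1 ≤ s.1 ∧ 1 ≤ s.2 ∧ parent s ∈ I) ∧
    (∀ s ∈ I, s = (1, 0) ∨ (1 ≤ s.1 ∧ 1 ≤ s.2 ∧ parent s ∈ I)) := by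
  induction h with
  | base =>
    refine ⟨by simp [sides], ?_, by simp⟩
    rintro ⟨x, y⟩
    simp only [sides, List.tail_cons, List.zip_cons_cons, List.zip_nil_right, List.mem_singleton,
      Prod.mk.injEq, Set.mem_singleton_iff, parent]
    split_ifs <;> simp only [Prod.mk.injEq] <;> omega
  | step u w a b I h ih =>
    obtain ⟨hnd, hmem, hI⟩ := ih
    have hab : (a, b) ∈ sides (u ++ a :: b :: w) := by rw [sides_split]; simp
    have hab' := (hmem _).1 hab
    obtain ⟨habI, ha, hb, hpar⟩ := hab'
    simp only at ha hb
    have hl : (a, a + b) ∉ I := fun hc => by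
      rcases hI _ hc with h1 | ⟨-, -, h1⟩
      · simp only [Prod.mk.injEq] at h1; omega
      · rw [parent_left] at h1; exact habI h1
    have hr : (a + b, b) ∉ I := fun hc => by
      rcases hI _ hc with h1 | ⟨-, -, h1⟩
      · simp only [Prod.mk.injEq] at h1; omega
      · rw [parent_right ha] at h1; exact habI h1
    have hs' : sides (u ++ a :: (a + b) :: b :: w) =
        sides (u ++ [a]) ++ (a, a + b) :: (a + b, b) :: sides (b :: w) := by
      rw [sides_split, sides_cons_cons]
    rw [sides_split] at hnd hmem
    have hl' : (a, a + b) ∉ sides (u ++ [a]) ++ (a, b) :: sides (b :: w) := by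
      rw [hmem, parent_left]; tauto
    have hr' : (a + b, b) ∉ sides (u ++ [a]) ++ (a, b) :: sides (b :: w) := by
      rw [hmem, parent_right ha]; tauto
    have hne : (a, a + b) ≠ (a + b, b) := by
      simp only [ne_eq, Prod.mk.injEq]; omega
    refine ⟨?_, ?_, ?_⟩
    · rw [hs']
      simp only [List.nodup_append, List.nodup_cons, List.mem_append, List.mem_cons] at hnd hl' hr' ⊢
      grind
    · intro s
      have key : s ∈ sides (u ++ [a]) ++ (a, a + b) :: (a + b, b) :: sides (b :: w) ↔
          ((s ∈ sides (u ++ [a]) ++ (a, b) :: sides (b :: w)) ∧ s ≠ (a, b)) ∨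
            s = (a, a + b) ∨ s = (a + b, b) := by
        simp only [List.nodup_append, List.nodup_cons, List.mem_append, List.mem_cons] at hnd ⊢
        grind
      rw [hs', key, hmem]
      simp only [Set.mem_insert_iff]
      constructor
      · rintro (⟨⟨h1, h2, h3, h4⟩, h5⟩ | rfl | rfl)
        · tauto
        · refine ⟨?_, ha, by simp only; omega, Or.inl parent_left⟩
          rintro (h1 | h1)
          · simp only [Prod.mk.injEq] at h1; omega
          · exact hl h1
        · refine ⟨?_, by simp only; omega, hb, Or.inl (parent_right ha)⟩
          rintro (h1 | h1)
          · simp only [Prod.mk.injEq] at h1; omega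
          · exact hr h1
      · rintro ⟨h1, h2, h3, h4 | h4⟩
        · exact Or.inr (eq_of_parent h4)
        · left; tauto
    · intro s hs
      rcases hs with rfl | hs
      · exact Or.inr ⟨ha, hb, Or.inr hpar⟩
      · rcases hI s hs with h1 | ⟨h1, h2, h3⟩
        · exact Or.inl h1
        · exact Or.inr ⟨h1, h2, Or.inr h3⟩

theorem nodup_sides (h : Triangulates L I) : (sides L).Nodup := h.sides_aux.1

theorem mem_sides (h : Triangulates L I) {s : ℕ × ℕ} :
    s ∈ sides L ↔ s ∉ I ∧ 1 ≤ s.1 ∧ 1 ≤ s.2 ∧ parent s ∈ I := h.sides_aux.2.1 s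

theorem parent_mem (h : Triangulates L I) {s : ℕ × ℕ} (hs : s ∈ I) :
    s = (1, 0) ∨ (1 ≤ s.1 ∧ 1 ≤ s.2 ∧ parent s ∈ I) := h.sides_aux.2.2 s hs

theorem side_notMem {u w : List ℕ} {a b : ℕ} (h : Triangulates (u ++ a :: b :: w) I) :
    (a, b) ∉ I ∧ 1 ≤ a ∧ 1 ≤ b ∧ parent (a, b) ∈ I :=
  h.mem_sides.1 (by rw [sides_split]; simp)

theorem coprime (h : Triangulates L I) : ∀ s ∈ I, Nat.Coprime s.1 s.2 := by
  induction h with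
  | base => simp
  | step u w a b I h ih =>
    rintro s (rfl | hs)
    · exact coprime_of_parent (ih _ h.side_notMem.2.2.2)
    · exact ih s hs

theorem coprime_sides (h : Triangulates L I) {s : ℕ × ℕ} (hs : s ∈ sides L) :
    Nat.Coprime s.1 s.2 :=
  coprime_of_parent (h.coprime _ (h.mem_sides.1 hs).2.2.2)

theorem length_eq (h : Triangulates L I) : L.length = I.ncard + 1 := by
  induction h with
  | base => simp
  | step u w a b I h ih =>
    rw [Set.ncard_insert_of_notMem h.side_notMem.1 h.finite]
    simp only [List.length_append, List.length_cons] at ih ⊢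
    omega

theorem mem_iff (h : Triangulates L I) (e : ℕ) : e ∈ L ↔ ∃ s ∈ I, s.1 + s.2 = e := by
  induction h with
  | base => simp [eq_comm]
  | step u w a b I h ih =>
    simp only [List.mem_append, List.mem_cons, Set.mem_insert_iff, exists_eq_or_imp] at ih ⊢
    rw [← ih]
    grind

/-- Every split contributes one member. The value `1` is excluded because `{1, 1}` has two such
members but only the one pair `(1, 0)`. -/
theorem count_eq (h : Triangulates L I) {e : ℕ} (he : 2 ≤ e) :
    L.count e = {s ∈ I | s.1 + s.2 = e}.ncard := by
  induction h with
  | base =>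
    have : {s ∈ ({(1, 0)} : Set (ℕ × ℕ)) | s.1 + s.2 = e} = ∅ := by
      ext s
      simp only [Set.mem_ofPred_eq, Set.mem_singleton_iff, Set.mem_empty_iff_false, iff_false]
      rintro ⟨rfl, h⟩
      simp only at h
      omega
    rw [this, Set.ncard_empty]
    rw [List.count_eq_zero]
    simp
    omega
  | step u w a b I h ih =>
    by_cases hab : a + b = e
    · have : {s ∈ insert (a, b) I | s.1 + s.2 = e} = insert (a, b) {s ∈ I | s.1 + s.2 = e} := by
        ext s
        simp only [Set.mem_ofPred_eq, Set.mem_insert_iff]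
        constructor
        · tauto
        · rintro (rfl | h)
          · exact ⟨Or.inl rfl, hab⟩
          · tauto
      rw [this, Set.ncard_insert_of_notMem (fun hc => h.side_notMem.1 hc.1)
        (h.finite.subset (fun s hs => hs.1)), ← ih]
      simp only [List.count_append, List.count_cons, beq_iff_eq, hab]
      simp
      omega
    · have : {s ∈ insert (a, b) I | s.1 + s.2 = e} = {s ∈ I | s.1 + s.2 = e} := by
        ext s
        simp only [Set.mem_ofPred_eq, Set.mem_insert_iff]
        constructor
        · rintro ⟨rfl | h, h'⟩
          · exact absurd h' hab
          · exact ⟨h, h'⟩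
        · tauto
      rw [this, ← ih]
      simp only [List.count_append, List.count_cons, beq_iff_eq]
      rw [if_neg hab]
      rfl

end Triangulates

theorem IsFareySequence.exists_triangulates {L : List ℕ} (h : IsFareySequence L) :
    ∃ I, Triangulates L I := by
  induction h with
  | refl => exact ⟨_, Triangulates.base⟩
  | tail _ h ih =>
    obtain ⟨I, hI⟩ := ih
    cases h with
    | mk u w a b => exact ⟨_, hI.step u w a b⟩

/-! ### Effect of the insertions on the set of triangles -/

theorem sides_nodup_split {u w : List ℕ} {a b : ℕ} (h : (sides (u ++ a :: b :: w)).Nodup) :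
    (a, b) ∉ sides (u ++ [a]) ∧ (a, b) ∉ sides (b :: w) := by
  rw [sides_split, List.nodup_append] at h
  simp only [List.nodup_cons, List.mem_cons] at h
  grind

theorem exists_split_of_mem_sides {L : List ℕ} {a b : ℕ} (h : (a, b) ∈ sides L) :
    ∃ u w, L = u ++ a :: b :: w := by
  induction L with
  | nil => simp [sides] at h
  | cons c L ih =>
    cases L with
    | nil => simp [sides] at h
    | cons d L =>
      rw [sides_cons_cons, List.mem_cons] at h
      rcases h with h | h
      · simp only [Prod.mk.injEq] at h
        exact ⟨[], L, by simp [h]⟩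
      · obtain ⟨u, w, h⟩ := ih h
        exact ⟨c :: u, w, by simp [h]⟩

theorem insertInSide_of_notMem (s : ℕ × ℕ) (m : List ℕ) (L : List ℕ) (h : s ∉ sides L) :
    insertInSide s m L = L := by
  induction L with
  | nil => rfl
  | cons c L ih =>
    cases L with
    | nil => rfl
    | cons d L =>
      rw [sides_cons_cons, List.mem_cons, not_or] at h
      rw [insertInSide, if_neg (fun hc => h.1 hc.symm), ih h.2]

theorem insertInSide_split (u w : List ℕ) (a b : ℕ) (m : List ℕ)
    (h : (sides (u ++ a :: b :: w)).Nodup) :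
    insertInSide (a, b) m (u ++ a :: b :: w) = u ++ a :: (m ++ b :: w) := by
  have h2 := sides_nodup_split h
  induction u with
  | nil =>
    rw [List.nil_append, insertInSide, if_pos rfl, insertInSide_of_notMem _ _ _ h2.2, List.nil_append]
  | cons c u ih =>
    cases u with
    | nil =>
      simp only [List.cons_append, List.nil_append, sides_cons_cons, List.mem_cons,
        List.nodup_cons] at h h2 ⊢
      rw [insertInSide, if_neg (by grind)]
      have := ih (by simpa [sides_cons_cons] using h.2) ⟨by simp [sides], h2.2⟩
      simp only [List.nil_append] at this
      rw [this]
    | cons d u =>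
      simp only [List.cons_append, sides_cons_cons, List.mem_cons, List.nodup_cons] at h h2 ih ⊢
      rw [insertInSide, if_neg (by grind), ih h.2 (by tauto)]

/-- Insertion of `a + b, …, a + m b` into the side `(a, b)`. -/
theorem Triangulates.insert_left {u w : List ℕ} {a b : ℕ} {I : Set (ℕ × ℕ)}
    (h : Triangulates (u ++ a :: b :: w) I) (m : ℕ) :
    Triangulates (u ++ a :: ((List.range' 1 m).map (fun k => a + k * b) ++ b :: w))
      (I ∪ {s | ∃ k < m, s = (a + k * b, b)}) ∧
    Refines (u ++ a :: b :: w)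
      (u ++ a :: ((List.range' 1 m).map (fun k => a + k * b) ++ b :: w)) := by
  induction m with
  | zero => simpa using ⟨h, Relation.ReflTransGen.refl⟩
  | succ m ih =>
    have key : ∃ v : List ℕ, a :: ((List.range' 1 m).map (fun k => a + k * b)) =
        v ++ [a + m * b] := by
      cases m with
      | zero => exact ⟨[], by simp⟩
      | succ m =>
        refine ⟨a :: (List.range' 1 m).map (fun k => a + k * b), ?_⟩
        rw [List.range'_concat]
        simp [add_comm 1 m]
    obtain ⟨v, hv⟩ := key
    have e1 : u ++ a :: ((List.range' 1 m).map (fun k => a + k * b) ++ b :: w) =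
        (u ++ v) ++ (a + m * b) :: b :: w := by
      rw [← List.cons_append, hv]; simp
    have e2 : u ++ a :: ((List.range' 1 (m + 1)).map (fun k => a + k * b) ++ b :: w) =
        (u ++ v) ++ (a + m * b) :: (a + m * b + b) :: b :: w := by
      rw [List.range'_concat, List.map_append, List.append_assoc, ← List.cons_append, hv]
      simp; ring
    rw [e1] at ih
    rw [e2]
    refine ⟨?_, ih.2.tail (InsertStep.mk _ _ _ _)⟩
    convert ih.1.step _ _ _ _ _ using 1
    ext s
    simp only [Set.mem_union, Set.mem_ofPred_eq, Set.mem_insert_iff]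
    constructor
    · rintro (h | ⟨k, hk, rfl⟩)
      · tauto
      · rcases Nat.lt_succ_iff_lt_or_eq.1 hk with hk | rfl
        · exact Or.inr (Or.inr ⟨k, hk, rfl⟩)
        · exact Or.inl rfl
    · rintro (rfl | h | ⟨k, hk, rfl⟩)
      · exact Or.inr ⟨m, by omega, rfl⟩
      · exact Or.inl h
      · exact Or.inr ⟨k, by omega, rfl⟩

/-- Insertion of `y + m x, …, y + x` into the side `(x, y)`. -/
theorem Triangulates.insert_right {u w : List ℕ} {x y : ℕ} {I : Set (ℕ × ℕ)}
    (h : Triangulates (u ++ x :: y :: w) I) (m : ℕ) :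
    Triangulates (u ++ x :: (((List.range' 1 m).map (fun k => y + k * x)).reverse ++ y :: w))
      (I ∪ {s | ∃ k < m, s = (x, y + k * x)}) ∧
    Refines (u ++ x :: y :: w)
      (u ++ x :: (((List.range' 1 m).map (fun k => y + k * x)).reverse ++ y :: w)) := by
  induction m with
  | zero => simpa using ⟨h, Relation.ReflTransGen.refl⟩
  | succ m ih =>
    have key : ∃ v : List ℕ, ((List.range' 1 m).map (fun k => y + k * x)).reverse ++ y :: w =
        (y + m * x) :: v := by
      cases m with
      | zero => exact ⟨w, by simp⟩
      | succ m =>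
        refine ⟨((List.range' 1 m).map (fun k => y + k * x)).reverse ++ y :: w, ?_⟩
        rw [List.range'_concat]
        simp [add_comm 1 m]
    obtain ⟨v, hv⟩ := key
    have e2 : u ++ x :: (((List.range' 1 (m + 1)).map (fun k => y + k * x)).reverse ++ y :: w) =
        u ++ x :: (x + (y + m * x)) :: (y + m * x) :: v := by
      rw [List.range'_concat, List.map_append, List.reverse_append, List.append_assoc, hv]
      simp; ring
    rw [hv] at ih
    rw [e2]
    refine ⟨?_, ih.2.tail (InsertStep.mk _ _ _ _)⟩
    convert ih.1.step _ _ _ _ _ using 1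
    ext s
    simp only [Set.mem_union, Set.mem_ofPred_eq, Set.mem_insert_iff]
    constructor
    · rintro (h | ⟨k, hk, rfl⟩)
      · tauto
      · rcases Nat.lt_succ_iff_lt_or_eq.1 hk with hk | rfl
        · exact Or.inr (Or.inr ⟨k, hk, rfl⟩)
        · exact Or.inl rfl
    · rintro (rfl | h | ⟨k, hk, rfl⟩)
      · exact Or.inr ⟨m, by omega, rfl⟩
      · exact Or.inl h
      · exact Or.inr ⟨k, by omega, rfl⟩

theorem Triangulates.insertInSide_left {L : List ℕ} {a b : ℕ} {I : Set (ℕ × ℕ)}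
    (h : Triangulates L I) (hs : (a, b) ∈ sides L) (m : ℕ) :
    Triangulates (insertInSide (a, b) ((List.range' 1 m).map fun k => a + k * b) L)
      (I ∪ {s | ∃ k < m, s = (a + k * b, b)}) ∧
    Refines L (insertInSide (a, b) ((List.range' 1 m).map fun k => a + k * b) L) := by
  obtain ⟨u, w, rfl⟩ := exists_split_of_mem_sides hs
  rw [insertInSide_split _ _ _ _ _ h.nodup_sides]
  exact h.insert_left m

theorem Triangulates.insertInSide_right {L : List ℕ} {x y : ℕ} {I : Set (ℕ × ℕ)}
    (h : Triangulates L I) (hs : (x, y) ∈ sides L) (m : ℕ) :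
    Triangulates (insertInSide (x, y) ((List.range' 1 m).map fun k => y + k * x).reverse L)
      (I ∪ {s | ∃ k < m, s = (x, y + k * x)}) ∧
    Refines L (insertInSide (x, y) ((List.range' 1 m).map fun k => y + k * x).reverse L) := by
  obtain ⟨u, w, rfl⟩ := exists_split_of_mem_sides hs
  rw [insertInSide_split _ _ _ _ _ h.nodup_sides]
  exact h.insert_right m

/-- The prefix `u` holds the part already processed. The two sides created by an insertion are never
examined again, so only sides of the original list are split. -/
theorem Triangulates.insertWhere_aux (P : ℕ → ℕ → Prop) [∀ a b, Decidable (P a b)] (l : List ℕ) :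
    ∀ (u : List ℕ) (I : Set (ℕ × ℕ)), Triangulates (u ++ l) I →
    Triangulates (u ++ insertWhere P l) (I ∪ {s | s ∈ sides l ∧ P s.1 s.2}) ∧
    Refines (u ++ l) (u ++ insertWhere P l) := by
  induction l with
  | nil =>
    intro u I h
    exact ⟨by simpa [insertWhere, sides] using h, Relation.ReflTransGen.refl⟩
  | cons a l ih =>
    cases l with
    | nil =>
      intro u I h
      exact ⟨by simpa [insertWhere, sides] using h, Relation.ReflTransGen.refl⟩
    | cons b l =>
      intro u I h
      rw [insertWhere]
      split_ifs with hP
      · have := ih (u ++ [a, a + b]) (insert (a, b) I) (by simpa using h.step u l a b I)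
        simp only [List.append_assoc, List.cons_append, List.nil_append] at this
        refine ⟨?_, (Relation.ReflTransGen.single (InsertStep.mk u l a b)).trans this.2⟩
        convert this.1 using 1
        ext s
        simp only [Set.mem_union, Set.mem_ofPred_eq, Set.mem_insert_iff, sides_cons_cons,
          List.mem_cons]
        grind
      · have := ih (u ++ [a]) I (by simpa using h)
        simp only [List.append_assoc, List.cons_append, List.nil_append] at this
        refine ⟨?_, this.2⟩
        convert this.1 using 1
        ext s
        simp only [Set.mem_union, Set.mem_ofPred_eq, sides_cons_cons, List.mem_cons]
        grind

theorem Triangulates.insertWhere {L : List ℕ} {I : Set (ℕ × ℕ)} (h : Triangulates L I)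
    (P : ℕ → ℕ → Prop) [∀ a b, Decidable (P a b)] :
    Triangulates (insertWhere P L) (I ∪ {s | s ∈ sides L ∧ P s.1 s.2}) ∧
    Refines L (DKLT.insertWhere P L) :=
  Triangulates.insertWhere_aux P L [] I h

/-! ### Triangles and sides of `F_r` -/

/-- The pairs that are split in the construction of `F_r`, and `(1, 0)`. -/
def fareyNodes (r : ℕ) : Set (ℕ × ℕ) :=
  {s | s = (1, 0) ∨ (1 ≤ s.1 ∧ 1 ≤ s.2 ∧ Nat.Coprime s.1 s.2 ∧ s.1 + s.2 ≤ r)}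

theorem fareyF_triangulates (r : ℕ) : Triangulates (fareyF r) (fareyNodes r) := by
  induction r with
  | zero =>
    have : fareyNodes 0 = {(1, 0)} := by
      ext s
      simp only [fareyNodes, Set.mem_ofPred_eq, Set.mem_singleton_iff, or_iff_left_iff_imp]
      omega
    rw [this]
    exact Triangulates.base
  | succ r ih =>
    have := (ih.insertWhere (fun a b => a + b = r + 1)).1
    rw [fareyF]
    convert this using 1
    ext ⟨x, y⟩
    simp only [Set.mem_union, Set.mem_ofPred_eq, ih.mem_sides, fareyNodes, Prod.mk.injEq]
    constructor
    · rintro (h | ⟨h1, h2, h3, h4⟩)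
      · tauto
      · rcases Nat.lt_or_ge r (x + y) with h5 | h5
        · right
          refine ⟨⟨by omega, h1, h2, ?_⟩, by omega⟩
          have hc := coprime_parent (s := (x, y)) h3
          revert hc
          simp only [parent]
          split_ifs with hxy
          · intro hc
            simp only [Prod.mk.injEq] at hc ⊢
            rcases hxy.eq_or_lt with rfl | hlt
            · left; simpa using hc
            · right; exact ⟨h1, by omega, hc, by omega⟩
          · intro hc
            right
            exact ⟨by simp only; omega, h2, hc, by simp only; omega⟩
        · tauto
    · rintro (h | ⟨⟨h1, h2, h3, h4⟩, h5⟩)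
      · rcases h with h | h
        · exact Or.inl h
        · exact Or.inr ⟨h.1, h.2.1, h.2.2.1, by omega⟩
      · refine Or.inr ⟨h2, h3, ?_, h5.le⟩
        refine coprime_of_parent (s := (x, y)) ?_
        rcases h4 with h4 | h4
        · rw [h4]; simp
        · exact h4.2.2.1

/-- Sides of `F_r`. -/
def IsFareySide (r : ℕ) (s : ℕ × ℕ) : Prop :=
  1 ≤ s.1 ∧ 1 ≤ s.2 ∧ s.1 ≤ r ∧ s.2 ≤ r ∧ Nat.Coprime s.1 s.2 ∧ r < s.1 + s.2

/-- `fareyF 0` is `{1, 1}`, whose side exceeds the bound `0`; hence `1 ≤ r`. -/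
theorem mem_sides_fareyF {r : ℕ} (hr : 1 ≤ r) {s : ℕ × ℕ} :
    s ∈ sides (fareyF r) ↔ IsFareySide r s := by
  obtain ⟨x, y⟩ := s
  rw [(fareyF_triangulates r).mem_sides]
  simp only [fareyNodes, IsFareySide, Set.mem_ofPred_eq, Prod.mk.injEq]
  constructor
  · rintro ⟨h1, h2, h3, h4⟩
    have hc : Nat.Coprime x y := by
      refine coprime_of_parent (s := (x, y)) ?_
      rcases h4 with h4 | h4
      · rw [h4]; simp
      · exact h4.2.2.1
    refine ⟨h2, h3, ?_, ?_, hc, ?_⟩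
    · revert h4; simp only [parent]; split_ifs <;> simp only [Prod.mk.injEq] <;> omega
    · revert h4; simp only [parent]; split_ifs <;> simp only [Prod.mk.injEq] <;> omega
    · by_contra h
      exact h1 (Or.inr ⟨h2, h3, hc, by omega⟩)
  · rintro ⟨h1, h2, h3, h4, h5, h6⟩
    refine ⟨by omega, h1, h2, ?_⟩
    have hc := coprime_parent (s := (x, y)) h5
    revert hc
    simp only [parent]
    split_ifs with hxy
    · intro hc
      simp only [Prod.mk.injEq] at hc ⊢
      rcases hxy.eq_or_lt with rfl | hlt
      · left; simpa using hc
      · right; exact ⟨h1, by omega, hc, by omega⟩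
    · intro hc
      right
      exact ⟨by simp only; omega, h2, hc, by simp only; omega⟩

/-! ### Classes of triangles modulo Γ₀(2^n), and pairing -/

/-- The residue class `e / q` modulo `N`. -/
noncomputable def frac (N : ℕ) (q e : ℤ) : ZMod N := (e : ZMod N) * (q : ZMod N)⁻¹

theorem isUnit_of_odd (n : ℕ) {q : ℤ} (hq : Odd q) : IsUnit (q : ZMod (2 ^ n)) := by
  rw [ZMod.coe_int_isUnit_iff_isCoprime]
  push_cast
  obtain ⟨k, rfl⟩ := hq
  exact IsCoprime.pow_left ⟨-k, 1, by ring⟩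

/-- Odd denominators are units modulo `2 ^ n`, so the inverses in `frac` are genuine and cross
multiplication decides equality. Later computations with classes use this form. -/
theorem frac_eq_iff {n : ℕ} {q e q' e' : ℤ} (hq : Odd q) (hq' : Odd q') :
    frac (2 ^ n) q e = frac (2 ^ n) q' e' ↔ (2 ^ n : ℤ) ∣ q * e' - q' * e := by
  have h1 := ZMod.mul_inv_of_unit _ (isUnit_of_odd n hq)
  have h2 := ZMod.mul_inv_of_unit _ (isUnit_of_odd n hq')
  have h3 : (2 ^ n : ℤ) ∣ q * e' - q' * e ↔ ((q * e' - q' * e : ℤ) : ZMod (2 ^ n)) = 0 := by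
    rw [ZMod.intCast_zmod_eq_zero_iff_dvd]
    push_cast
    rfl
  rw [h3]
  push_cast
  unfold frac
  constructor
  · intro h
    linear_combination (-(q * q' : ZMod (2 ^ n))) * h + (q' * e : ZMod (2 ^ n)) * h1 -
      (q * e' : ZMod (2 ^ n)) * h2
  · intro h
    linear_combination (-((q : ZMod (2 ^ n))⁻¹ * (q' : ZMod (2 ^ n))⁻¹)) * h +
      (e' * (q' : ZMod (2 ^ n))⁻¹) * h1 - (e * (q : ZMod (2 ^ n))⁻¹) * h2

theorem frac_congr_of_eq {N : ℕ} {q e q' e' : ℤ} (h1 : q = q') (h2 : e = e') :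
    frac N q e = frac N q' e' := by rw [h1, h2]

/-- The map `(q, e) ↦ (q + e, e)` has determinant one and preserves `q * e' - q' * e`. So does the
flip below; both moves are thus well defined on classes. -/
theorem frac_add {n : ℕ} {q e q' e' : ℤ} (hq : Odd q) (hq' : Odd q') (he : Even e) (he' : Even e')
    (h : frac (2 ^ n) q e = frac (2 ^ n) q' e') :
    frac (2 ^ n) (q + e) e = frac (2 ^ n) (q' + e') e' := by
  rw [frac_eq_iff hq hq'] at h
  rw [frac_eq_iff (hq.add_even he) (hq'.add_even he')]
  convert h using 1
  ring

theorem frac_flip {n : ℕ} {q e q' e' : ℤ} (hq : Odd q) (hq' : Odd q') (he : Even e)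
    (he' : Even e') (h : frac (2 ^ n) q e = frac (2 ^ n) q' e') :
    frac (2 ^ n) (q + e) (-(2 * q + e)) = frac (2 ^ n) (q' + e') (-(2 * q' + e')) := by
  rw [frac_eq_iff hq hq'] at h
  rw [frac_eq_iff (hq.add_even he) (hq'.add_even he')]
  convert h using 1
  ring

/-- The triangle below the edge `(a, b)`, as a class modulo `N`: the quotient of the even vertex
by the next one in the cyclic order. -/
noncomputable def cls (N : ℕ) (s : ℕ × ℕ) : ZMod N :=
  -- The signed vertices in cyclic order are `b`, `a`, `-(a + b)`; each branch divides the even one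
  -- by its successor.
  if Even s.2 then frac N s.1 s.2
  else if Even s.1 then frac N (-(s.1 + s.2)) s.1 else frac N (-s.2) (s.1 + s.2)

theorem cls_even_right (N : ℕ) {a b : ℕ} (hb : Even b) : cls N (a, b) = frac N a b := by
  simp [cls, hb]

theorem cls_even_left (N : ℕ) {a b : ℕ} (ha : Even a) (hb : Odd b) :
    cls N (a, b) = frac N (-(a + b)) a := by
  simp [cls, ha, Nat.not_even_iff_odd.2 hb]

theorem cls_odd_odd (N : ℕ) {a b : ℕ} (ha : Odd a) (hb : Odd b) :
    cls N (a, b) = frac N (-b) (a + b) := by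
  simp [cls, Nat.not_even_iff_odd.2 ha, Nat.not_even_iff_odd.2 hb]

/-- The three possible parities of a coprime pair. -/
theorem parity_cases {a b : ℕ} (h : Nat.Coprime a b) :
    (Odd a ∧ Even b) ∨ (Even a ∧ Odd b) ∨ (Odd a ∧ Odd b) := by
  rcases Nat.even_or_odd a with ha | ha <;> rcases Nat.even_or_odd b with hb | hb
  · have := Nat.dvd_gcd ha.two_dvd hb.two_dvd
    rw [h] at this
    omega
  all_goals tauto

theorem odd_cast {a : ℕ} (h : Odd a) : Odd (a : ℤ) := by exact_mod_cast h

theorem even_cast {a : ℕ} (h : Even a) : Even (a : ℤ) := by exact_mod_cast h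

theorem cls_eq_frac (N : ℕ) {s : ℕ × ℕ} (h : Nat.Coprime s.1 s.2) :
    ∃ q e : ℤ, Odd q ∧ Even e ∧ cls N s = frac N q e := by
  obtain ⟨a, b⟩ := s
  rcases parity_cases h with ⟨ha, hb⟩ | ⟨ha, hb⟩ | ⟨ha, hb⟩
  · exact ⟨_, _, odd_cast ha, even_cast hb, cls_even_right N hb⟩
  · exact ⟨_, _, ((even_cast ha).add_odd (odd_cast hb)).neg, even_cast ha, cls_even_left N ha hb⟩
  · exact ⟨_, _, (odd_cast hb).neg, (odd_cast ha).add_odd (odd_cast hb), cls_odd_odd N ha hb⟩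

theorem parent_cases {a b : ℕ} (ha : 1 ≤ a) (hb : 1 ≤ b) :
    (∃ c, b = a + c ∧ parent (a, b) = (a, c)) ∨
      ∃ c, 1 ≤ c ∧ a = c + b ∧ parent (a, b) = (c, b) := by
  rcases Nat.lt_or_ge b a with h | h
  · obtain ⟨c, rfl⟩ := Nat.exists_eq_add_of_lt h
    refine Or.inr ⟨c + 1, by omega, by omega, ?_⟩
    rw [show b + c + 1 = (c + 1) + b by ring, parent_right (by omega)]
  · obtain ⟨c, rfl⟩ := Nat.exists_eq_add_of_le h
    exact Or.inl ⟨c, rfl, parent_left⟩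

section parents

variable {n a b : ℕ} (ha' : 1 ≤ a) (hb' : 1 ≤ b)
include ha' hb'

/-- Up to a common sign, the triangle above `(a, b)` has the signed vertices `a`, `-b`, `b - a` in
this cyclic order, whichever entry is larger. This gives the formulas for all three parities. -/
theorem cls_parent_even_right (ha : Odd a) (hb : Even b) :
    cls (2 ^ n) (parent (a, b)) = frac (2 ^ n) (a - b) b := by
  rcases parent_cases ha' hb' with ⟨c, rfl, h⟩ | ⟨c, -, rfl, h⟩ <;> rw [h]
  · have hc : Odd c := by grind
    rw [cls_odd_odd _ ha hc]
    apply frac_congr_of_eq <;> push_cast <;> ring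
  · have hc : Odd c := by grind
    rw [cls_even_right _ hb]
    apply frac_congr_of_eq <;> push_cast <;> ring

theorem cls_parent_even_left (ha : Even a) (hb : Odd b) :
    cls (2 ^ n) (parent (a, b)) = frac (2 ^ n) (-b) a := by
  rcases parent_cases ha' hb' with ⟨c, rfl, h⟩ | ⟨c, -, rfl, h⟩ <;> rw [h]
  · have hc : Odd c := by grind
    rw [cls_even_left _ ha hc]
    apply frac_congr_of_eq <;> push_cast <;> ring
  · have hc : Odd c := by grind
    rw [cls_odd_odd _ hc hb]
    apply frac_congr_of_eq <;> push_cast <;> ring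

theorem cls_parent_odd_odd (ha : Odd a) (hb : Odd b) :
    cls (2 ^ n) (parent (a, b)) = frac (2 ^ n) a (b - a) := by
  rcases parent_cases ha' hb' with ⟨c, rfl, h⟩ | ⟨c, -, rfl, h⟩ <;> rw [h]
  · have hc : Even c := by grind
    rw [cls_even_right _ hc]
    apply frac_congr_of_eq <;> push_cast <;> ring
  · have hc : Even c := by grind
    rw [cls_even_left _ hc hb, frac_eq_iff (by grind) (by grind)]
    exact ⟨0, by push_cast; ring⟩

end parents

theorem isPaired_iff_int {N : ℕ} {a b x y : ℕ} :
    IsPaired N (a, b) (x, y) ↔ (N : ℤ) ∣ a * x + b * y := by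
  unfold IsPaired
  exact_mod_cast Iff.rfl

/-- Modulo `4`, for coprime entries, `a ^ 2 + b ^ 2` is `1` or `2`, and `a ^ 2 + a * b + b ^ 2` is
odd. -/
theorem not_isElliptic {n : ℕ} (hn : 2 ≤ n) {s : ℕ × ℕ} (h : Nat.Coprime s.1 s.2) :
    ¬ IsElliptic (2 ^ n) s := by
  obtain ⟨a, b⟩ := s
  have h4 : 4 ∣ 2 ^ n := pow_dvd_pow 2 hn
  rintro (h1 | h1) <;> replace h1 := h4.trans h1 <;> simp only at h1 <;>
    rcases parity_cases h with ⟨⟨c, hc⟩, ⟨d, hd⟩⟩ | ⟨⟨c, hc⟩, ⟨d, hd⟩⟩ | ⟨⟨c, hc⟩, ⟨d, hd⟩⟩ <;>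
    subst hc <;> subst hd <;> ring_nf at h1 <;> omega

theorem isPaired_symm {N : ℕ} {s t : ℕ × ℕ} (h : IsPaired N s t) : IsPaired N t s := by
  unfold IsPaired at h ⊢
  rwa [mul_comm t.1, mul_comm t.2]

/-- Up to sign, `a x + b y` is the cross product that compares the triangle below `s` with the
triangle above `t`. Pairing therefore glues the two sides with their ends interchanged, which
explains the swapped parities. -/
theorem isPaired_iff {n : ℕ} (hn : 1 ≤ n) {s t : ℕ × ℕ} (hs : Nat.Coprime s.1 s.2)
    (ht : Nat.Coprime t.1 t.2) (ht1 : 1 ≤ t.1) (ht2 : 1 ≤ t.2) :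
    IsPaired (2 ^ n) s t ↔
      s.1 % 2 = t.2 % 2 ∧ s.2 % 2 = t.1 % 2 ∧ cls (2 ^ n) s = cls (2 ^ n) (parent t) := by
  obtain ⟨a, b⟩ := s
  obtain ⟨x, y⟩ := t
  simp only at ht1 ht2 hs ht ⊢
  have key : IsPaired (2 ^ n) (a, b) (x, y) → a % 2 = y % 2 ∧ b % 2 = x % 2 := by
    intro h
    have h2 : 2 ∣ a * x + b * y := (dvd_pow_self 2 (by omega)).trans h
    rw [← even_iff_two_dvd, Nat.even_add, Nat.even_mul, Nat.even_mul] at h2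
    rcases parity_cases hs with ⟨h3, h4⟩ | ⟨h3, h4⟩ | ⟨h3, h4⟩ <;>
    rcases parity_cases ht with ⟨h5, h6⟩ | ⟨h5, h6⟩ | ⟨h5, h6⟩ <;> grind
  have main : a % 2 = y % 2 → b % 2 = x % 2 →
      (IsPaired (2 ^ n) (a, b) (x, y) ↔ cls (2 ^ n) (a, b) = cls (2 ^ n) (parent (x, y))) := by
    intro h1 h2
    rw [isPaired_iff_int]
    push_cast
    rcases parity_cases hs with ⟨ha, hb⟩ | ⟨ha, hb⟩ | ⟨ha, hb⟩
    · have hx : Even x := by grind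
      have hy : Odd y := by grind
      rw [cls_even_right _ hb, cls_parent_even_left ht1 ht2 hx hy, frac_eq_iff (by grind) (by grind)]
      apply Iff.of_eq; congr 1; ring
    · have hx : Odd x := by grind
      have hy : Even y := by grind
      rw [cls_even_left _ ha hb, cls_parent_even_right ht1 ht2 hx hy,
        frac_eq_iff (by grind) (by grind), ← dvd_neg]
      apply Iff.of_eq; congr 1; ring
    · have hx : Odd x := by grind
      have hy : Odd y := by grind
      rw [cls_odd_odd _ ha hb, cls_parent_odd_odd ht1 ht2 hx hy,
        frac_eq_iff (by grind) (by grind), ← dvd_neg]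
      apply Iff.of_eq; congr 1; ring
  constructor
  · intro h
    obtain ⟨h1, h2⟩ := key h
    exact ⟨h1, h2, (main h1 h2).1 h⟩
  · rintro ⟨h1, h2, h3⟩
    exact (main h1 h2).2 h3

theorem eq_of_parent_eq {s t : ℕ × ℕ} (hs : Nat.Coprime s.1 s.2) (h : parent s = parent t)
    (h1 : s.1 % 2 = t.1 % 2) (h2 : s.2 % 2 = t.2 % 2) : s = t := by
  obtain ⟨⟨a, b⟩, hab⟩ : ∃ p, p = parent t := ⟨_, rfl⟩
  have hc := coprime_parent hs
  rw [h, ← hab] at hc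
  have := parity_cases hc
  rcases eq_of_parent (h.trans hab.symm) with rfl | rfl <;>
    rcases eq_of_parent hab.symm with rfl | rfl <;> first | rfl | (exfalso; simp only at h1 h2; grind)

/-- Two edges of the same parity type in the same class lie above triangles of the same class. -/
theorem cls_parent_congr {n : ℕ} {s t : ℕ × ℕ} (hs : Nat.Coprime s.1 s.2)
    (hs1 : 1 ≤ s.1) (hs2 : 1 ≤ s.2) (ht1 : 1 ≤ t.1) (ht2 : 1 ≤ t.2)
    (h1 : s.1 % 2 = t.1 % 2) (h2 : s.2 % 2 = t.2 % 2) (h : cls (2 ^ n) s = cls (2 ^ n) t) :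
    cls (2 ^ n) (parent s) = cls (2 ^ n) (parent t) := by
  obtain ⟨a, b⟩ := s
  obtain ⟨x, y⟩ := t
  simp only at hs1 hs2 ht1 ht2 hs h1 h2
  rcases parity_cases hs with ⟨ha, hb⟩ | ⟨ha, hb⟩ | ⟨ha, hb⟩
  · have hx : Odd x := by grind
    have hy : Even y := by grind
    rw [cls_even_right _ hb, cls_even_right _ hy, frac_eq_iff (by grind) (by grind)] at h
    rw [cls_parent_even_right hs1 hs2 ha hb, cls_parent_even_right ht1 ht2 hx hy,
      frac_eq_iff (by grind) (by grind)]
    convert h using 1; ring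
  · have hx : Even x := by grind
    have hy : Odd y := by grind
    rw [cls_even_left _ ha hb, cls_even_left _ hx hy, frac_eq_iff (by grind) (by grind)] at h
    rw [cls_parent_even_left hs1 hs2 ha hb, cls_parent_even_left ht1 ht2 hx hy,
      frac_eq_iff (by grind) (by grind)]
    convert h using 1; ring
  · have hx : Odd x := by grind
    have hy : Odd y := by grind
    rw [cls_odd_odd _ ha hb, cls_odd_odd _ hx hy, frac_eq_iff (by grind) (by grind)] at h
    rw [cls_parent_odd_odd hs1 hs2 ha hb, cls_parent_odd_odd ht1 ht2 hx hy,
      frac_eq_iff (by grind) (by grind)]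
    convert h using 1; ring

/-! ### Moves across edges, and partners of sides -/

/-- `C` is closed under passing to the next triangle around the even vertex. -/
def PlusClosed (N : ℕ) (C : Set (ZMod N)) : Prop :=
  ∀ q e : ℤ, Odd q → Even e → frac N q e ∈ C → frac N (q + e) e ∈ C

/-- `C` is closed under passing to the triangle across the edge opposite to the even vertex. -/
def FlipClosed (N : ℕ) (C : Set (ZMod N)) : Prop :=
  ∀ q e : ℤ, Odd q → Even e → frac N q e ∈ C → frac N (q + e) (-(2 * q + e)) ∈ C

theorem PlusClosed.iterate {n : ℕ} {C : Set (ZMod (2 ^ n))} (h : PlusClosed (2 ^ n) C) {q e : ℤ}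
    (hq : Odd q) (he : Even e) (hC : frac (2 ^ n) q e ∈ C) (m : ℕ) :
    frac (2 ^ n) (q + m * e) e ∈ C := by
  induction m with
  | zero => simpa using hC
  | succ m ih =>
    have := h _ _ (hq.add_even (he.mul_left _)) he ih
    convert this using 1
    apply frac_congr_of_eq <;> push_cast <;> ring

theorem PlusClosed.sub_mem {n : ℕ} {C : Set (ZMod (2 ^ n))} (h : PlusClosed (2 ^ n) C) {q e : ℤ}
    (hq : Odd q) (he : Even e) (hC : frac (2 ^ n) q e ∈ C) :
    frac (2 ^ n) (q - e) e ∈ C := by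
  have := h.iterate hq he hC (2 ^ n - 1)
  convert this using 1
  rw [frac_eq_iff (hq.sub_even he) (hq.add_even (he.mul_left _)), Nat.cast_sub Nat.one_le_two_pow]
  exact ⟨-e * e, by push_cast; ring⟩

namespace Triangulates

variable {L : List ℕ} {I : Set (ℕ × ℕ)} {n : ℕ}

theorem mem_or_side (h : Triangulates L I) {s : ℕ × ℕ} (h1 : 1 ≤ s.1) (h2 : 1 ≤ s.2)
    (hp : parent s ∈ I) : s ∈ I ∨ s ∈ sides L := by
  rw [h.mem_sides]; tauto

theorem pos_of_mem (h : Triangulates L I) {a b : ℕ} (hs : (a, b) ∈ I) (hb : b ≠ 0) :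
    1 ≤ a ∧ 1 ≤ b := by
  rcases h.parent_mem hs with h1 | ⟨h1, h2, -⟩
  · simp only [Prod.mk.injEq] at h1; omega
  · exact ⟨h1, h2⟩

theorem fst_pos (h : Triangulates L I) {a b : ℕ} (hs : (a, b) ∈ I) : 1 ≤ a := by
  rcases h.parent_mem hs with h1 | ⟨h1, h2, -⟩
  · simp only [Prod.mk.injEq] at h1; omega
  · exact h1

/-- Depending on which vertex is even, rotation leads to a child or to the parent. Only the passage
to a child can leave the polygon, and then through a side with odd first and even second entry. The
triangle `(1, 0)` rotates to its own class. -/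
theorem plusClosed (h : Triangulates L I)
    (hp : ∀ s ∈ sides L, Odd s.1 → Even s.2 → cls (2 ^ n) s ∈ cls (2 ^ n) '' I) :
    PlusClosed (2 ^ n) (cls (2 ^ n) '' I) := by
  rintro q e hq he ⟨⟨a, b⟩, hs, hqe⟩
  rcases parity_cases (h.coprime _ hs) with ⟨ha, hb⟩ | ⟨ha, hb⟩ | ⟨ha, hb⟩
  · rw [cls_even_right _ hb] at hqe
    rw [← frac_add (by grind) hq (by grind) he hqe]
    rcases Nat.eq_zero_or_pos b with rfl | hb0
    · exact ⟨_, hs, by rw [cls_even_right _ hb]; simp⟩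
    · have ha0 := h.fst_pos hs
      have : cls (2 ^ n) (a + b, b) ∈ cls (2 ^ n) '' I := by
        rcases h.mem_or_side (s := (a + b, b)) (by simp only; omega) hb0
          (by rwa [parent_right ha0]) with h1 | h1
        · exact ⟨_, h1, rfl⟩
        · exact hp _ h1 (by grind) hb
      rw [cls_even_right _ hb] at this
      push_cast at this
      exact this
  · have hpos := h.pos_of_mem hs (by rintro rfl; simp at hb)
    rw [cls_even_left _ ha hb] at hqe
    rw [← frac_add (by grind) hq (by grind) he hqe]
    rcases h.parent_mem hs with h1 | ⟨h1, h2, h3⟩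
    · simp only [Prod.mk.injEq] at h1; omega
    · refine ⟨_, h3, ?_⟩
      rw [cls_parent_even_left hpos.1 hpos.2 ha hb]
      apply frac_congr_of_eq <;> ring
  · rw [cls_odd_odd _ ha hb] at hqe
    rw [← frac_add (by grind) hq (by grind) he hqe]
    have ha0 := h.fst_pos hs
    have : cls (2 ^ n) (a, a + b) ∈ cls (2 ^ n) '' I := by
      rcases h.mem_or_side (s := (a, a + b)) ha0 (by simp only; omega)
        (by rwa [parent_left]) with h1 | h1
      · exact ⟨_, h1, rfl⟩
      · exact hp _ h1 ha (by grind)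
    rw [cls_even_right _ (by grind)] at this
    convert this using 1
    apply frac_congr_of_eq <;> push_cast <;> ring

/-- The edge opposite to the even vertex has two odd entries, so a flip leaves the polygon only
through a side of that type. -/
theorem flipClosed (h : Triangulates L I)
    (hp : ∀ s ∈ sides L, Odd s.1 → Odd s.2 → cls (2 ^ n) s ∈ cls (2 ^ n) '' I) :
    FlipClosed (2 ^ n) (cls (2 ^ n) '' I) := by
  rintro q e hq he ⟨⟨a, b⟩, hs, hqe⟩
  have ha0 := h.fst_pos hs
  rcases parity_cases (h.coprime _ hs) with ⟨ha, hb⟩ | ⟨ha, hb⟩ | ⟨ha, hb⟩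
  · rw [cls_even_right _ hb] at hqe
    rw [← frac_flip (by grind) hq (by grind) he hqe]
    have : cls (2 ^ n) (a, a + b) ∈ cls (2 ^ n) '' I := by
      rcases h.mem_or_side (s := (a, a + b)) ha0 (by simp only; omega)
        (by rwa [parent_left]) with h1 | h1
      · exact ⟨_, h1, rfl⟩
      · exact hp _ h1 ha (by grind)
    rw [cls_odd_odd _ ha (by grind)] at this
    convert this using 1
    rw [frac_eq_iff (by grind) (by grind)]
    exact ⟨0, by push_cast; ring⟩
  · have hpos := h.pos_of_mem hs (by rintro rfl; simp at hb)
    rw [cls_even_left _ ha hb] at hqe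
    rw [← frac_flip (by grind) hq (by grind) he hqe]
    have : cls (2 ^ n) (a + b, b) ∈ cls (2 ^ n) '' I := by
      rcases h.mem_or_side (s := (a + b, b)) (by simp only; omega) hpos.2
        (by rwa [parent_right ha0]) with h1 | h1
      · exact ⟨_, h1, rfl⟩
      · exact hp _ h1 (by grind) hb
    rw [cls_odd_odd _ (by grind) hb] at this
    convert this using 1
    apply frac_congr_of_eq <;> push_cast <;> ring
  · rw [cls_odd_odd _ ha hb] at hqe
    rw [← frac_flip (by grind) hq (by grind) he hqe]
    rcases h.parent_mem hs with h1 | ⟨h1, h2, h3⟩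
    · simp only [Prod.mk.injEq] at h1; grind
    · refine ⟨_, h3, ?_⟩
      rw [cls_parent_odd_odd h1 h2 ha hb]
      apply frac_congr_of_eq <;> ring

/-- If the classes of the triangles are closed under rotation around even vertices, then they
contain the classes of the triangles below all sides with an even entry. -/
theorem cls_side_mem (h : Triangulates L I) (hC : PlusClosed (2 ^ n) (cls (2 ^ n) '' I))
    {s : ℕ × ℕ} (hs : s ∈ sides L) (hodd : ¬ (Odd s.1 ∧ Odd s.2)) :
    cls (2 ^ n) s ∈ cls (2 ^ n) '' I := by
  have hco := h.coprime_sides hs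
  obtain ⟨-, h1, h2, h3⟩ := h.mem_sides.1 hs
  obtain ⟨a, b⟩ := s
  have h4 : cls (2 ^ n) (parent (a, b)) ∈ cls (2 ^ n) '' I := ⟨_, h3, rfl⟩
  rcases parity_cases hco with ⟨ha, hb⟩ | ⟨ha, hb⟩ | ⟨ha, hb⟩
  · rw [cls_parent_even_right h1 h2 ha hb] at h4
    have := hC _ _ (by grind) (by grind) h4
    rw [cls_even_right _ hb]
    convert this using 1
    apply frac_congr_of_eq <;> ring
  · rw [cls_parent_even_left h1 h2 ha hb] at h4
    -- Here the side is crossed against the sense of rotation.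
    have := hC.sub_mem (by grind) (by grind) h4
    rw [cls_even_left _ ha hb]
    convert this using 1
    apply frac_congr_of_eq <;> ring
  · exact absurd ⟨ha, hb⟩ hodd

theorem pairing_unique (h : Triangulates L I) (hn : 1 ≤ n) (hinj : Set.InjOn (cls (2 ^ n)) I)
    {s t t' : ℕ × ℕ} (hs : Nat.Coprime s.1 s.2) (ht : t ∈ sides L) (ht' : t' ∈ sides L)
    (hst : IsPaired (2 ^ n) s t) (hst' : IsPaired (2 ^ n) s t') : t = t' := by
  obtain ⟨-, h1, h2, h3⟩ := h.mem_sides.1 ht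
  obtain ⟨-, h1', h2', h3'⟩ := h.mem_sides.1 ht'
  rw [isPaired_iff hn hs (h.coprime_sides ht) h1 h2] at hst
  rw [isPaired_iff hn hs (h.coprime_sides ht') h1' h2'] at hst'
  exact eq_of_parent_eq (h.coprime_sides ht)
    (hinj h3 h3' (hst.2.2.symm.trans hst'.2.2)) (by omega) (by omega)

theorem cls_mem_of_paired (h : Triangulates L I) (hn : 1 ≤ n) {s t : ℕ × ℕ}
    (hs : s ∈ sides L) (ht : t ∈ sides L) (hst : IsPaired (2 ^ n) s t) :
    cls (2 ^ n) s ∈ cls (2 ^ n) '' I := by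
  obtain ⟨-, h1, h2, h3⟩ := h.mem_sides.1 ht
  rw [isPaired_iff hn (h.coprime_sides hs) (h.coprime_sides ht) h1 h2] at hst
  exact ⟨_, h3, hst.2.2.symm⟩

/-- If the triangle below a side is equivalent to one of the triangulation, then the side is
paired with a side. -/
theorem exists_paired (h : Triangulates L I) (hn : 1 ≤ n) (hinj : Set.InjOn (cls (2 ^ n)) I)
    {s : ℕ × ℕ} (hs : s ∈ sides L) (hC : cls (2 ^ n) s ∈ cls (2 ^ n) '' I) :
    ∃ t ∈ sides L, IsPaired (2 ^ n) s t := by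
  obtain ⟨⟨c, d⟩, hD, hcls⟩ := hC
  have hco := h.coprime_sides hs
  obtain ⟨hsI, hs1, hs2, hs3⟩ := h.mem_sides.1 hs
  have hcoD := h.coprime _ hD
  -- a child of `(c, d)` with the parity type dual to that of `s` does the job
  have key : ∀ t : ℕ × ℕ, 1 ≤ t.1 → 1 ≤ t.2 → parent t = (c, d) → s.1 % 2 = t.2 % 2 →
      s.2 % 2 = t.1 % 2 → ∃ t ∈ sides L, IsPaired (2 ^ n) s t := by
    intro t ht1 ht2 htp h1 h2
    have htco : Nat.Coprime t.1 t.2 := coprime_of_parent (by rw [htp]; exact hcoD)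
    have hst : IsPaired (2 ^ n) s t := by
      rw [isPaired_iff hn hco htco ht1 ht2, htp]
      exact ⟨h1, h2, hcls.symm⟩
    -- If `t` were split, symmetry of pairing and injectivity would make it the parent of `s`, which
    -- the dual parities of `s` and `t` exclude.
    rcases h.mem_or_side ht1 ht2 (htp ▸ hD) with h3 | h3
    · exfalso
      have h4 := isPaired_symm hst
      rw [isPaired_iff hn htco hco hs1 hs2] at h4
      have h5 := hinj h3 hs3 h4.2.2
      have h6 := eq_of_parent (a := t.1) (b := t.2) h5.symm
      have h7 := parity_cases htco
      rcases h6 with h6 | h6 <;> rw [h6] at h1 h2 <;> simp only at h1 h2 <;> grind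
    · exact ⟨t, h3, hst⟩
  rcases Nat.eq_zero_or_pos d with rfl | hd
  · have hc1 : c = 1 := by simpa using hcoD
    subst hc1
    by_cases hodd : Odd s.1 ∧ Odd s.2
    · exact key (1, 1) le_rfl le_rfl (by simp [parent]) (by grind) (by grind)
    -- The class is zero, which rotation fixes. So the triangle above `s` would be `(1, 0)` as well,
    -- whose only child with positive entries is `(1, 1)`.
    · exfalso
      obtain ⟨a, b⟩ := s
      simp only at hs1 hs2 hco hodd
      have h0 : cls (2 ^ n) (1, 0) = frac (2 ^ n) 1 0 := by
        rw [cls_even_right _ (by simp)]; simp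
      rw [h0] at hcls
      have : cls (2 ^ n) (parent (a, b)) = cls (2 ^ n) (1, 0) := by
        rw [h0]
        rcases parity_cases hco with ⟨ha, hb⟩ | ⟨ha, hb⟩ | ⟨ha, hb⟩
        · rw [cls_even_right _ hb, frac_eq_iff (by simp) (by grind)] at hcls
          rw [cls_parent_even_right hs1 hs2 ha hb, frac_eq_iff (by grind) (by simp)]
          simpa using hcls
        · rw [cls_even_left _ ha hb, frac_eq_iff (by simp) (by grind)] at hcls
          rw [cls_parent_even_left hs1 hs2 ha hb, frac_eq_iff (by grind) (by simp)]
          simpa using hcls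
        · exact absurd ⟨ha, hb⟩ hodd
      have h5 := hinj hs3 hD this
      rcases eq_of_parent h5 with h6 | h6 <;> simp only [Prod.mk.injEq] at h6
      · rw [h6.1, h6.2] at hodd; simp at hodd
      · omega
  · have hc := h.fst_pos hD
    -- For equal parity types `s` corresponds to the upper edge `(c, d)`: the triangles above both
    -- are equivalent, hence equal, and `s = (c, d)` would already be split.
    by_cases hsame : s.1 % 2 = c % 2 ∧ s.2 % 2 = d % 2
    · exfalso
      have h1 := cls_parent_congr (t := (c, d)) hco hs1 hs2 hc hd hsame.1 hsame.2 hcls.symm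
      rcases h.parent_mem hD with h2 | ⟨-, -, h2⟩
      · simp only [Prod.mk.injEq] at h2; omega
      · have h3 := eq_of_parent_eq (t := (c, d)) hco (hinj hs3 h2 h1) hsame.1 hsame.2
        exact hsI (h3 ▸ hD)
    · by_cases h1 : s.1 % 2 = (c + d) % 2 ∧ s.2 % 2 = c % 2
      · exact key (c, c + d) hc (by simp only; omega) parent_left h1.1 h1.2
      · refine key (c + d, d) (by simp only; omega) hd (parent_right hc) ?_ ?_ <;>
        · have h2 := parity_cases hco
          have h3 := parity_cases hcoD
          simp only
          grind

end Triangulates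

/-! ### The index of Γ₀(2^n) -/

section index

open Matrix MatrixGroups

/-- A matrix with first column `(1, k)`. -/
def oddRep (k : ℤ) : SL(2, ℤ) := ⟨!![1, 0; k, 1], by simp⟩

/-- A matrix with first column `(2 k, 1)`. -/
def evenRep (k : ℤ) : SL(2, ℤ) := ⟨!![2 * k, -1; 1, 0], by simp⟩

theorem oddRep_col (k : ℤ) : oddRep k 0 0 = 1 ∧ oddRep k 1 0 = k := ⟨rfl, rfl⟩

theorem evenRep_col (k : ℤ) : evenRep k 0 0 = 2 * k ∧ evenRep k 1 0 = 1 := ⟨rfl, rfl⟩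

/-- Cosets correspond to first columns up to units, that is, to points of the projective line over
`ℤ / 2 ^ n`: there are `2 ^ n` points `(1 : k)` and `2 ^ (n - 1)` points `(2 k : 1)`. -/
theorem gamma0_index {n : ℕ} (hn : 1 ≤ n) :
    (CongruenceSubgroup.Gamma0 (2 ^ n)).index = 3 * 2 ^ (n - 1) := by
  have hpow : 2 ^ n = 2 * 2 ^ (n - 1) := by rw [← pow_succ', Nat.sub_add_cancel hn]
  have hrel : ∀ A B : SL(2, ℤ), (A : SL(2, ℤ) ⧸ CongruenceSubgroup.Gamma0 (2 ^ n)) = B ↔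
      (2 ^ n : ℤ) ∣ A 0 0 * B 1 0 - A 1 0 * B 0 0 := by
    intro A B
    have h10 : (A⁻¹ * B) 1 0 = A 0 0 * B 1 0 - A 1 0 * B 0 0 := by
      rw [Matrix.SpecialLinearGroup.coe_mul, Matrix.SpecialLinearGroup.coe_inv,
        Matrix.adjugate_fin_two, Matrix.mul_apply, Fin.sum_univ_two]
      simp
      ring
    rw [QuotientGroup.eq, CongruenceSubgroup.Gamma0_mem, ZMod.intCast_zmod_eq_zero_iff_dvd, h10]
    push_cast
    rfl
  have hcast : (2 : ℤ) ^ n = ((2 ^ n : ℕ) : ℤ) := by push_cast; rfl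
  have hbij : Function.Bijective (Sum.elim
      (fun k : Fin (2 ^ n) => (oddRep k : SL(2, ℤ) ⧸ CongruenceSubgroup.Gamma0 (2 ^ n)))
      (fun k : Fin (2 ^ (n - 1)) =>
        (evenRep k : SL(2, ℤ) ⧸ CongruenceSubgroup.Gamma0 (2 ^ n)))) := by
    constructor
    · rintro (⟨k, hk⟩ | ⟨k, hk⟩) (⟨l, hl⟩ | ⟨l, hl⟩) h <;>
        simp only [Sum.elim_inl, Sum.elim_inr, hrel, oddRep_col, evenRep_col, one_mul, mul_one] at h
      · have h1 := Int.eq_zero_of_abs_lt_dvd h (by rw [hcast, abs_lt]; omega)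
        simp; omega
      · exfalso
        have h2 : (2 : ℤ) ∣ 1 - k * (2 * l) := (dvd_pow_self 2 (by omega)).trans h
        have : (2 : ℤ) ∣ 1 := by
          rw [show (1 : ℤ) = (1 - k * (2 * l)) + 2 * (k * l) by ring]
          exact dvd_add h2 (dvd_mul_right _ _)
        omega
      · exfalso
        have h2 : (2 : ℤ) ∣ 2 * k * l - 1 := (dvd_pow_self 2 (by omega)).trans h
        have : (2 : ℤ) ∣ 1 := by
          rw [show (1 : ℤ) = 2 * (k * l) - (2 * k * l - 1) by ring]
          exact dvd_sub (dvd_mul_right _ _) h2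
        omega
      · have h1 := Int.eq_zero_of_abs_lt_dvd h (by
          rw [hcast, abs_lt]; omega)
        simp; omega
    · intro x
      obtain ⟨A, rfl⟩ := QuotientGroup.mk_surjective x
      have hdet : A 0 0 * A 1 1 - A 0 1 * A 1 0 = 1 := by
        have := A.det_coe
        rwa [Matrix.det_fin_two] at this
      -- solve `a k ≡ c` for odd `a`
      have solve : ∀ a c : ℤ, Odd a → ∃ k : ℕ, k < 2 ^ n ∧ (2 ^ n : ℤ) ∣ k * a - c := by
        intro a c ha
        have hu := ZMod.mul_inv_of_unit _ (isUnit_of_odd n ha)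
        refine ⟨((c : ZMod (2 ^ n)) * (a : ZMod (2 ^ n))⁻¹).val, ZMod.val_lt _, ?_⟩
        have : ((2 ^ n : ℕ) : ℤ) ∣
            (((c : ZMod (2 ^ n)) * (a : ZMod (2 ^ n))⁻¹).val : ℤ) * a - c := by
          rw [← ZMod.intCast_zmod_eq_zero_iff_dvd]
          push_cast
          rw [ZMod.natCast_zmod_val]
          linear_combination (c : ZMod (2 ^ n)) * hu
        simpa using this
      rcases Int.even_or_odd (A 0 0) with ha | ha
      · have hc : Odd (A 1 0) := by
          by_contra hc
          rw [Int.not_odd_iff_even] at hc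
          have : Even (1 : ℤ) := by
            rw [← hdet]; exact (ha.mul_right _).sub (hc.mul_left _)
          simp at this
        obtain ⟨k, hk, hdvd⟩ := solve _ (A 0 0) hc
        have hke : Even (k : ℤ) := by
          have h2 : (2 : ℤ) ∣ k * A 1 0 - A 0 0 := (dvd_pow_self 2 (by omega)).trans hdvd
          rw [← even_iff_two_dvd, Int.even_sub, Int.even_mul] at h2
          have := Int.not_even_iff_odd.2 hc
          tauto
        obtain ⟨l, hl⟩ := hke
        obtain ⟨m, rfl⟩ : ∃ m : ℕ, k = 2 * m := ⟨k / 2, by omega⟩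
        refine ⟨Sum.inr ⟨m, by omega⟩, ?_⟩
        simp only [Sum.elim_inr, hrel, evenRep_col, one_mul]
        push_cast at hdvd
        exact hdvd
      · obtain ⟨k, hk, hdvd⟩ := solve _ (A 1 0) ha
        refine ⟨Sum.inl ⟨k, hk⟩, ?_⟩
        simp only [Sum.elim_inl, hrel, oddRep_col, one_mul]
        rw [← dvd_neg, neg_sub]
        exact hdvd
  have := Nat.card_congr (Equiv.ofBijective _ hbij)
  rw [Subgroup.index, ← this, Nat.card_eq_fintype_card]
  simp
  omega

/-- The centre consists of scalar matrices and lies in Γ₀, so the quotient keeps the index. -/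
theorem gammaZero_index {n : ℕ} (hn : 1 ≤ n) : (gammaZero (2 ^ n)).index = 3 * 2 ^ (n - 1) := by
  rw [gammaZero, Subgroup.index_map, QuotientGroup.ker_mk',
    MonoidHom.range_eq_top.2 (QuotientGroup.mk'_surjective _), Subgroup.index_top, mul_one,
    sup_eq_left.2, gamma0_index hn]
  intro A hA
  rw [Matrix.SpecialLinearGroup.mem_center_iff] at hA
  obtain ⟨r, -, hr⟩ := hA
  have h10 : A 1 0 = 0 := by
    rw [← hr, Matrix.scalar_apply, Matrix.diagonal_apply_ne _ (by decide)]
  rw [CongruenceSubgroup.Gamma0_mem, h10, Int.cast_zero]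

end index

/-! ### Reaching all classes; recognition of Farey sequences of Γ₀(2^n) -/

/-- Dividing by the unit `c` makes the numerator `2 ^ j`, and rotation then shifts the denominator
by multiples of `2 ^ j`. It remains to treat denominators that are odd residues `a` modulo `2 ^ j`,
and these come from the triangles `(a, 2 ^ j - a)` of `F_r`. -/
theorem PlusClosed.mem_of_two_pow {n r : ℕ} (hn : 1 ≤ n) {C : Set (ZMod (2 ^ n))}
    (hC : PlusClosed (2 ^ n) C) (hF : ∀ s ∈ fareyNodes r, cls (2 ^ n) s ∈ C) {q c : ℤ} {j : ℕ}
    (hj : 1 ≤ j) (hjr : 2 ^ j ≤ r) (hq : Odd q) (hc : Odd c) :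
    frac (2 ^ n) q (2 ^ j * c) ∈ C := by
  have hev : Even ((2 : ℤ) ^ j) := by
    rw [Int.even_pow]; exact ⟨by decide, by omega⟩
  have hevn : Even ((2 : ℤ) ^ n) := by
    rw [Int.even_pow]; exact ⟨by decide, by omega⟩
  obtain ⟨u, v, huv⟩ : IsCoprime ((2 : ℤ) ^ n) c := by
    obtain ⟨k, rfl⟩ := hc
    exact IsCoprime.pow_left ⟨-k, 1, by ring⟩
  have hv : Odd v := by
    by_contra hv
    rw [Int.not_odd_iff_even] at hv
    have : Even (1 : ℤ) := by
      rw [← huv]; exact (hevn.mul_left _).add (hv.mul_right _)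
    simp at this
  have hp : Odd (q * v) := hq.mul hv
  obtain ⟨a, ha⟩ : ∃ a : ℕ, (a : ℤ) = q * v % 2 ^ j :=
    ⟨(q * v % 2 ^ j).toNat, Int.toNat_of_nonneg (Int.emod_nonneg _ (by positivity))⟩
  have hdiv := Int.emod_add_mul_ediv (q * v) (2 ^ j)
  rw [← ha] at hdiv
  have haodd : Odd (a : ℤ) := by
    rw [← hdiv] at hp
    have : Even ((2 : ℤ) ^ j * (q * v / 2 ^ j)) := hev.mul_right _
    grind
  have halt : a < 2 ^ j := by
    have := Int.emod_lt_of_pos (q * v) (b := 2 ^ j) (by positivity)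
    rw [← ha] at this
    exact_mod_cast this
  have haodd' : Odd a := by exact_mod_cast haodd
  have hnode : (a, 2 ^ j - a) ∈ fareyNodes r := by
    refine Or.inr ⟨haodd'.pos, by simp only; omega, ?_, by simp only; omega⟩
    simp only
    rw [Nat.coprime_sub_self_right halt.le]
    exact (Nat.coprime_two_right.2 haodd').pow_right j
  have h1 := hF _ hnode
  have hb : Odd (2 ^ j - a) := by
    have : Even (2 ^ j) := by rw [Nat.even_pow]; exact ⟨by decide, by omega⟩
    grind
  rw [cls_odd_odd _ haodd' hb, Nat.cast_sub halt.le] at h1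
  push_cast at h1
  rw [show -((2 : ℤ) ^ j - a) = a - 2 ^ j by ring, show (a : ℤ) + (2 ^ j - a) = 2 ^ j by ring] at h1
  obtain ⟨m, hm⟩ : ∃ m : ℕ, (m : ℤ) = (q * v / 2 ^ j + 1) % 2 ^ n :=
    ⟨((q * v / 2 ^ j + 1) % 2 ^ n).toNat,
      Int.toNat_of_nonneg (Int.emod_nonneg _ (by positivity))⟩
  have hdiv2 := Int.emod_add_mul_ediv (q * v / 2 ^ j + 1) (2 ^ n)
  rw [← hm] at hdiv2
  have h2 := hC.iterate (haodd.sub_even hev) hev h1 m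
  convert h2 using 1
  rw [frac_eq_iff hq ((haodd.sub_even hev).add_even (hev.mul_left _))]
  generalize q * v / 2 ^ j = k at hdiv hdiv2
  generalize (k + 1) / 2 ^ n = w at hdiv2
  refine ⟨2 ^ j * (u * q + 2 ^ j * c * w), ?_⟩
  linear_combination (-(2 : ℤ) ^ j * q) * huv + (-(2 : ℤ) ^ j * c) * hdiv -
    ((2 : ℤ) ^ j * 2 ^ j * c) * hdiv2

/-- If `e / 2` is odd, rotation suffices. Otherwise a flip connects the class with one whose
numerator has odd half. -/
theorem frac_mem_of_closed {n r : ℕ} (hn : 1 ≤ n) (hr : 2 ≤ r) {C : Set (ZMod (2 ^ n))}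
    (hC : PlusClosed (2 ^ n) C) (hC' : FlipClosed (2 ^ n) C)
    (hF : ∀ s ∈ fareyNodes r, cls (2 ^ n) s ∈ C) {q e : ℤ} (hq : Odd q) (he : Even e) :
    frac (2 ^ n) q e ∈ C := by
  obtain ⟨c, rfl⟩ := even_iff_two_dvd.1 he
  rcases Int.even_or_odd c with hc | hc
  · have h1 : frac (2 ^ n) (q + 2 * c) (2 ^ 1 * (-(q + c))) ∈ C :=
      hC.mem_of_two_pow hn hF le_rfl hr (by grind) (by grind)
    have h2 := hC' _ _ (by grind) (by grind) h1
    convert h2 using 1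
    rw [frac_eq_iff hq (by grind)]
    exact ⟨0, by ring⟩
  · simpa using hC.mem_of_two_pow (j := 1) hn hF le_rfl hr hq hc

theorem evenClasses_ncard {n : ℕ} (hn : 1 ≤ n) :
    {w | ∃ q e : ℤ, Odd q ∧ Even e ∧ frac (2 ^ n) q e = w}.ncard = 2 ^ (n - 1) := by
  have hpow : 2 ^ n = 2 * 2 ^ (n - 1) := by rw [← pow_succ', Nat.sub_add_cancel hn]
  have himg : {w | ∃ q e : ℤ, Odd q ∧ Even e ∧ frac (2 ^ n) q e = w} =
      (fun i : ℕ => ((2 * i : ℕ) : ZMod (2 ^ n))) '' (Set.Iio (2 ^ (n - 1))) := by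
    ext w
    constructor
    · rintro ⟨q, e, hq, ⟨c, rfl⟩, rfl⟩
      obtain ⟨z, hz⟩ : ∃ z : ℕ, (z : ZMod (2 ^ n)) = c * (q : ZMod (2 ^ n))⁻¹ :=
        ⟨_, ZMod.natCast_zmod_val _⟩
      refine ⟨z % 2 ^ (n - 1), Nat.mod_lt _ (by positivity), ?_⟩
      simp only [frac]
      rw [← Nat.mul_mod_mul_left, ← hpow]
      push_cast [ZMod.natCast_mod]
      rw [hz]; ring
    · rintro ⟨i, -, rfl⟩
      refine ⟨1, 2 * i, odd_one, even_two_mul _, ?_⟩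
      simp [frac]
  rw [himg, Set.InjOn.ncard_image, Set.ncard_Iio_nat]
  intro i hi j hj hij
  simp only [Set.mem_Iio] at hi hj
  simp only at hij
  rw [ZMod.natCast_eq_natCast_iff'] at hij
  rw [Nat.mod_eq_of_lt (by omega), Nat.mod_eq_of_lt (by omega)] at hij
  omega

namespace Triangulates

variable {L : List ℕ} {I : Set (ℕ × ℕ)} {n : ℕ}

/-- A Farey sequence of `Γ₀(2 ^ n)` is recognized by its triangles. -/
theorem isFareySequenceOf (h : Triangulates L I) (hn : 2 ≤ n)
    (href : Refines (fareyF (Nat.sqrt (2 ^ n))) L) (hinj : Set.InjOn (cls (2 ^ n)) I)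
    (hF : fareyNodes (Nat.sqrt (2 ^ n)) ⊆ I) (hplus : PlusClosed (2 ^ n) (cls (2 ^ n) '' I))
    (hdiv : ∀ s ∈ sides L, Odd s.1 → Odd s.2 → ¬ 2 ^ ((n + 1) / 2) ∣ s.1 + s.2) :
    IsFareySequenceOf (2 ^ n) L := by
  have hF' : ∀ s ∈ fareyNodes (Nat.sqrt (2 ^ n)), cls (2 ^ n) s ∈ cls (2 ^ n) '' I :=
    fun s hs => ⟨s, hF hs, rfl⟩
  have hr : 2 ≤ Nat.sqrt (2 ^ n) := by
    rw [Nat.le_sqrt]; exact (Nat.pow_le_pow_right (by norm_num) hn : 2 ^ 2 ≤ 2 ^ n)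
  have hall : ∀ s ∈ sides L, cls (2 ^ n) s ∈ cls (2 ^ n) '' I := by
    intro s hs
    by_cases hodd : Odd s.1 ∧ Odd s.2
    · obtain ⟨a, b⟩ := s
      have hd := hdiv _ hs hodd.1 hodd.2
      obtain ⟨-, h1, h2, -⟩ := h.mem_sides.1 hs
      simp only at hodd hd h1 h2
      obtain ⟨j, c, hc, hjc⟩ := Nat.exists_eq_two_pow_mul_odd (n := a + b) (by omega)
      have hj : 1 ≤ j := by
        by_contra hj
        have : j = 0 := by omega
        subst this
        grind
      -- This gives `2 * j ≤ n`, so `2 ^ j` is within the order of `F_r`.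
      have hj2 : j < (n + 1) / 2 := by
        by_contra hj2
        exact hd ((pow_dvd_pow 2 (not_lt.1 hj2)).trans (hjc ▸ dvd_mul_right _ _))
      have hjr : 2 ^ j ≤ Nat.sqrt (2 ^ n) := by
        rw [Nat.le_sqrt, ← pow_add]
        exact Nat.pow_le_pow_right (by norm_num) (by omega)
      rw [cls_odd_odd _ hodd.1 hodd.2]
      have := hplus.mem_of_two_pow (by omega) hF' hj hjr (odd_cast hodd.2).neg (odd_cast hc)
      convert this using 1
      apply frac_congr_of_eq rfl
      exact_mod_cast hjc
    · exact h.cls_side_mem hplus hs hodd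
  have hflip := h.flipClosed (n := n) fun s hs _ _ => hall s hs
  have himg : cls (2 ^ n) '' I = {w | ∃ q e : ℤ, Odd q ∧ Even e ∧ frac (2 ^ n) q e = w} := by
    ext w
    constructor
    · rintro ⟨s, hs, rfl⟩
      obtain ⟨q, e, hq, he, hqe⟩ := cls_eq_frac (2 ^ n) (h.coprime s hs)
      exact ⟨q, e, hq, he, hqe.symm⟩
    · rintro ⟨q, e, hq, he, rfl⟩
      exact frac_mem_of_closed (by omega) hr hplus hflip hF' hq he
  refine ⟨h.isFareySequence, href, ?_, ?_⟩
  · rw [h.length_eq, gammaZero_index (by omega), ← hinj.ncard_image, himg,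
      evenClasses_ncard (by omega)]
    omega
  · intro s hs _
    obtain ⟨t, ht, hst⟩ := h.exists_paired (by omega) hinj hs (hall s hs)
    refine ⟨t, ⟨ht, hst⟩, ?_⟩
    rintro t' ⟨ht', hst'⟩
    exact h.pairing_unique (by omega) hinj (h.coprime_sides hs) ht' ht hst' hst

end Triangulates

/-! ### The class of `2 ^ (n - 1)`: lower bound and uniqueness -/

theorem two_pow_le_of_dvd {n : ℕ} (hn : 1 ≤ n) {q : ℤ} {e : ℕ} (hq : Odd q)
    (h : (2 ^ n : ℤ) ∣ q * 2 ^ (n - 1) - e) : 2 ^ (n - 1) ≤ e := by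
  have hpow : (2 : ℤ) ^ n = 2 * 2 ^ (n - 1) := by rw [← pow_succ', Nat.sub_add_cancel hn]
  obtain ⟨k, hk⟩ := h
  rw [hpow] at hk
  have he : (e : ℤ) = 2 ^ (n - 1) * (q - 2 * k) := by linear_combination -hk
  have hpos : 0 < q - 2 * k := by
    have h1 : 0 ≤ q - 2 * k := by
      by_contra hneg
      have : (2 : ℤ) ^ (n - 1) * (q - 2 * k) < 0 :=
        mul_neg_of_pos_of_neg (by positivity) (by omega)
      omega
    obtain ⟨l, rfl⟩ := hq
    omega
  have : (2 : ℤ) ^ (n - 1) ≤ e := by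
    rw [he]; exact le_mul_of_one_le_right (by positivity) (by omega)
  exact_mod_cast this

/-- For `n ≥ 3`, flip `0 / 1` to `-2 / 1`, rotate `2 ^ (n - 3)` times to the denominator `1 - 2 ^ (n
- 2)`, and flip again: the numerator becomes `2 ^ (n - 1)`. For `n = 2` the first flip suffices. -/
theorem frac_half_mem {n : ℕ} (hn : 2 ≤ n) {C : Set (ZMod (2 ^ n))}
    (hC : PlusClosed (2 ^ n) C) (hC' : FlipClosed (2 ^ n) C) (h0 : frac (2 ^ n) 1 0 ∈ C) :
    frac (2 ^ n) 1 (2 ^ (n - 1)) ∈ C := by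
  have h1 := hC' _ _ odd_one (by simp) h0
  norm_num at h1
  obtain ⟨m, rfl⟩ := Nat.exists_eq_add_of_le hn
  rcases m with _ | m
  · convert h1 using 1
    rw [frac_eq_iff odd_one odd_one]
    norm_num
  · have h2 := hC.iterate odd_one (by decide) h1 (2 ^ m)
    have h3 := hC' _ _ (odd_one.add_even (Even.mul_left (by decide) _)) (by decide) h2
    convert h3 using 1
    rw [frac_eq_iff odd_one (by grind)]
    refine ⟨1 + 2 ^ m, ?_⟩
    rw [show 2 + (m + 1) - 1 = m + 2 by omega]
    push_cast
    ring

/-- The even vertex is an odd multiple of `2 ^ (n - 1)`, and `s.1 + s.2` is the largest vertex. -/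
theorem le_add_of_cls_eq {n : ℕ} (hn : 1 ≤ n) {s : ℕ × ℕ} (hs : Nat.Coprime s.1 s.2)
    (h : cls (2 ^ n) s = frac (2 ^ n) 1 (2 ^ (n - 1))) : 2 ^ (n - 1) ≤ s.1 + s.2 := by
  obtain ⟨a, b⟩ := s
  simp only
  rcases parity_cases hs with ⟨ha, hb⟩ | ⟨ha, hb⟩ | ⟨ha, hb⟩
  · rw [cls_even_right _ hb, frac_eq_iff (by grind) odd_one, one_mul] at h
    exact (two_pow_le_of_dvd hn (by grind) h).trans (Nat.le_add_left _ _)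
  · rw [cls_even_left _ ha hb, frac_eq_iff (by grind) odd_one, one_mul] at h
    exact (two_pow_le_of_dvd hn (by grind) h).trans (Nat.le_add_right _ _)
  · rw [cls_odd_odd _ ha hb, frac_eq_iff (by grind) odd_one, one_mul] at h
    exact two_pow_le_of_dvd (q := -b) hn (by grind) (by push_cast; exact h)

theorem IsFareySequenceOf.exists_large {n : ℕ} (hn : 2 ≤ n) {F : List ℕ}
    (hF : IsFareySequenceOf (2 ^ n) F) : ∃ e ∈ F, 2 ^ (n - 1) ≤ e := by
  obtain ⟨I, h⟩ := hF.isFareySequence.exists_triangulates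
  have hall : ∀ s ∈ sides F, cls (2 ^ n) s ∈ cls (2 ^ n) '' I := by
    intro s hs
    obtain ⟨t, ⟨ht, hst⟩, -⟩ := hF.paired s hs (not_isElliptic hn (h.coprime_sides hs))
    exact h.cls_mem_of_paired (by omega) hs ht hst
  have h0 : frac (2 ^ n) 1 0 ∈ cls (2 ^ n) '' I :=
    ⟨_, h.base_mem, by rw [cls_even_right _ (by simp)]; simp⟩
  obtain ⟨s, hs, hcls⟩ := frac_half_mem hn (h.plusClosed fun s hs _ _ => hall s hs)
    (h.flipClosed fun s hs _ _ => hall s hs) h0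
  exact ⟨s.1 + s.2, (h.mem_iff _).2 ⟨s, hs, rfl⟩, le_add_of_cls_eq (by omega) (h.coprime s hs) hcls⟩

/-- The largest admissible member occurs exactly once. -/
theorem Triangulates.count_half {n : ℕ} (hn : 2 ≤ n) {L : List ℕ} {I : Set (ℕ × ℕ)}
    (h : Triangulates L I) (hL : IsFareySequenceOf (2 ^ n) L) (hinj : Set.InjOn (cls (2 ^ n)) I)
    (hle : ∀ e ∈ L, e ≤ 2 ^ (n - 1)) : L.count (2 ^ (n - 1)) = 1 := by
  have h2 : 2 ≤ 2 ^ (n - 1) := Nat.le_self_pow (by omega) 2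
  rw [h.count_eq h2, Set.ncard_eq_one]
  obtain ⟨e, he, hle'⟩ := hL.exists_large hn
  have he' := le_antisymm (hle e he) hle'
  subst he'
  obtain ⟨s, hs, hsum⟩ := (h.mem_iff _).1 he
  -- The even sum forces two odd entries, and all odd multiples of `2 ^ (n - 1)` agree modulo `2 ^
  -- n`. So such triangles share one class.
  have key : ∀ t ∈ I, t.1 + t.2 = 2 ^ (n - 1) →
      cls (2 ^ n) t = frac (2 ^ n) 1 (2 ^ (n - 1)) := by
    rintro ⟨a, b⟩ ht hab
    have hev : Even (2 ^ (n - 1)) := by rw [Nat.even_pow]; exact ⟨by decide, by omega⟩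
    simp only at hab
    rw [← hab] at hev
    rcases parity_cases (h.coprime _ ht) with ⟨ha, hb⟩ | ⟨ha, hb⟩ | ⟨ha, hb⟩
    · grind
    · grind
    · obtain ⟨k, hk⟩ := odd_cast hb
      rw [cls_odd_odd _ ha hb, frac_eq_iff (by grind) odd_one,
        show (a : ℤ) + b = 2 ^ (n - 1) by exact_mod_cast hab]
      refine ⟨-(k + 1), ?_⟩
      have hpow : (2 : ℤ) ^ n = 2 * 2 ^ (n - 1) := by
        rw [← pow_succ', Nat.sub_add_cancel (by omega)]
      rw [hpow, hk]; ring
  refine ⟨s, Set.eq_singleton_iff_unique_mem.2 ⟨⟨hs, hsum⟩, ?_⟩⟩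
  rintro t ⟨ht, htsum⟩
  exact hinj ht hs ((key t ht htsum).trans (key s hs hsum).symm)

/-! ### Fans around even vertices and their collisions -/

theorem eq_of_cross {a b c d : ℕ} (ha : 1 ≤ a) (hab : Nat.Coprime a b) (hcd : Nat.Coprime c d)
    (h : a * d = c * b) : a = c ∧ b = d := by
  have h1 : a ∣ c := hab.dvd_of_dvd_mul_right (h ▸ dvd_mul_right a d)
  have h2 : c ∣ a := hcd.dvd_of_dvd_mul_right (h.symm ▸ dvd_mul_right c b)
  have h3 := Nat.dvd_antisymm h1 h2
  subst h3
  exact ⟨rfl, (Nat.eq_of_mul_eq_mul_left ha h).symm⟩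

theorem side_eq_of_dvd {n r : ℕ} (hrn : r * r ≤ 2 ^ n) {a b c d : ℕ}
    (hs : IsFareySide r (a, b)) (ht : IsFareySide r (c, d))
    (h : (2 ^ n : ℤ) ∣ a * d - c * b) : a = c ∧ b = d := by
  obtain ⟨ha, hb, har, hbr, hco, -⟩ := hs
  obtain ⟨hc, hd, hcr, hdr, hco', -⟩ := ht
  simp only at *
  have hrn' : (r : ℤ) * r ≤ 2 ^ n := by exact_mod_cast hrn
  have h1 : a * d ≤ r * r := Nat.mul_le_mul har hdr
  have h2 : c * b ≤ r * r := Nat.mul_le_mul hcr hbr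
  have h3 : 0 < a * d := Nat.mul_pos ha hd
  have h4 : 0 < c * b := Nat.mul_pos hc hb
  have h0 : (a * d - c * b : ℤ) = 0 := by
    apply Int.eq_zero_of_abs_lt_dvd h
    zify at h1 h2 h3 h4
    rw [abs_lt]
    constructor <;> linarith
  exact eq_of_cross ha hco hco' (by zify; linarith)

theorem odd_fan {a b : ℕ} (ha : Odd a) (hb : Even b) (k : ℤ) : Odd (a + k * b : ℤ) :=
  (odd_cast ha).add_even ((even_cast hb).mul_left k)

theorem odd_fan_nat {a b : ℕ} (ha : Odd a) (hb : Even b) (k : ℕ) : Odd (a + k * b) :=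
  ha.add_even (hb.mul_left k)

/-- The pair `(a + k b, b)` is paired with a side of `F_r`. -/
def Hits (n r a b k : ℕ) : Prop := ∃ t, IsFareySide r t ∧ IsPaired (2 ^ n) (a + k * b, b) t

/-- If the fan of triangles above the side `(a, b)` of `F_r` runs into a triangle of `F_r`, then
it has passed a pair that is paired with a side of `F_r`. -/
theorem exists_hits_of_frac_eq {n r a b : ℕ} (hr : 2 ≤ r) (hrn : r * r ≤ 2 ^ n)
    (hab : IsFareySide r (a, b)) (ha : Odd a) (hb : Even b) (k : ℕ) :
    ∀ (q : ℤ) (d : ℕ), Odd q → Even d → 0 < d → d ≤ r → IsCoprime q (d : ℤ) → q + d ≤ r →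
      -(r : ℤ) ≤ q → frac (2 ^ n) (a + k * b) b = frac (2 ^ n) q d → ∃ k' ≤ k, Hits n r a b k' := by
  induction k with
  | zero =>
    intro q d hq hd hd0 hdr hco hqd hrq h
    rw [frac_eq_iff (odd_fan ha hb _) hq] at h
    obtain ⟨ha0, hb0, har, hbr, hcoab, habr⟩ := hab
    simp only at ha0 hb0 har hbr hcoab habr
    have hrn' : (r : ℤ) * r ≤ 2 ^ n := by exact_mod_cast hrn
    rcases lt_or_ge q 0 with hq0 | hq0
    · obtain ⟨f, rfl⟩ : ∃ f : ℕ, q = -f := ⟨q.natAbs, by omega⟩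
      by_cases hf : r < f + d
      · refine ⟨0, le_rfl, (d, f), ⟨hd0, by simp only; omega, hdr, by simp only; omega, ?_,
          by simp only; omega⟩, ?_⟩
        · simp only
          rw [← Nat.isCoprime_iff_coprime]
          exact (IsCoprime.neg_left_iff _ _).1 hco |>.symm
        · rw [isPaired_iff_int]
          push_cast at h ⊢
          convert h using 1
          ring
      · exfalso
        -- A positive multiple of `2 ^ n` would lie below `r * r`. Strictness holds because coprime
        -- `a` and `b` cannot both equal `r`.
        have h5 : (0 : ℤ) < a * d + f * b := by positivity
        have h6 : (a * d + f * b : ℤ) < 2 ^ n := by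
          have hfd : f + d ≤ r := by omega
          have h7 : a * d + f * b < r * r := by
            have hne : a ≠ r ∨ b ≠ r := by
              by_contra hc
              push Not at hc
              rw [hc.1, hc.2, Nat.coprime_self] at hcoab
              omega
            have hf0 : 0 < f := by omega
            calc a * d + f * b < r * d + f * r := by
                  rcases hne with hne | hne
                  · exact Nat.add_lt_add_of_lt_of_le
                      (Nat.mul_lt_mul_of_pos_right (by omega) hd0) (Nat.mul_le_mul_left _ hbr)
                  · exact Nat.add_lt_add_of_le_of_lt (Nat.mul_le_mul_right _ har)
                      (Nat.mul_lt_mul_of_pos_left (by omega) hf0)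
              _ = r * (f + d) := by ring
              _ ≤ r * r := Nat.mul_le_mul_left _ hfd
          zify at h7
          linarith
        have h7 := Int.le_of_dvd h5 (by convert h using 1; push_cast; ring)
        linarith
    · exfalso
      obtain ⟨f, rfl⟩ : ∃ f : ℕ, q = f := ⟨q.natAbs, by omega⟩
      have hf0 : 0 < f := by
        rcases Nat.eq_zero_or_pos f with rfl | h
        · simp at hq
        · exact h
      have h1 : a * d ≤ r * r := Nat.mul_le_mul har hdr
      have h2 : f * b ≤ r * r := Nat.mul_le_mul (by omega) hbr
      have h3 : 0 < a * d := Nat.mul_pos ha0 hd0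
      have h4 : 0 < f * b := Nat.mul_pos hf0 hb0
      have h0 : (a * d - f * b : ℤ) = 0 := by
        apply Int.eq_zero_of_abs_lt_dvd (m := 2 ^ n)
        · convert h using 1
          push_cast; ring
        · zify at h1 h2 h3 h4
          rw [abs_lt]
          constructor <;> linarith
      have := eq_of_cross ha0 hcoab (Nat.isCoprime_iff_coprime.1 hco) (by zify; linarith)
      omega
  | succ k ih =>
    intro q d hq hd hd0 hdr hco hqd hrq h
    -- Both triangles are rotated back together, `q` becoming `q - d`. Once `-q + d` exceeds `r`,
    -- the pair `(d, -q)` is a side of `F_r`, a hit; before that, `-r ≤ q - d` persists.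
    by_cases hf : q < 0 ∧ (r : ℤ) < -q + d
    · obtain ⟨f, rfl⟩ : ∃ f : ℕ, q = -f := ⟨q.natAbs, by omega⟩
      refine ⟨k + 1, le_rfl, (d, f), ⟨hd0, by simp only; omega, hdr, by simp only; omega, ?_,
          by simp only; omega⟩, ?_⟩
      · simp only
        rw [← Nat.isCoprime_iff_coprime]
        exact (IsCoprime.neg_left_iff _ _).1 hco |>.symm
      · rw [frac_eq_iff (odd_fan ha hb _) hq] at h
        rw [isPaired_iff_int]
        push_cast at h ⊢
        convert h using 1
        ring
    · obtain ⟨k', hk', hh⟩ := ih (q - d) d (hq.sub_even (even_cast hd)) hd hd0 hdr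
        (by have := hco.add_mul_right_left (-1); rwa [neg_one_mul, ← sub_eq_add_neg] at this)
        (by omega) (by omega) (by
          rw [frac_eq_iff (odd_fan ha hb _) hq] at h
          rw [frac_eq_iff (odd_fan ha hb _) (by grind)]
          convert h using 1
          push_cast; ring)
      exact ⟨k', by omega, hh⟩

theorem exists_hits_of_cls_eq {n r a b : ℕ} (hr : 2 ≤ r) (hrn : r * r ≤ 2 ^ n)
    (hab : IsFareySide r (a, b)) (ha : Odd a) (hb : Even b) {k : ℕ} {s : ℕ × ℕ}
    (hs : s ∈ fareyNodes r) (h : frac (2 ^ n) (a + k * b) b = cls (2 ^ n) s) :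
    ∃ k' ≤ k, Hits n r a b k' := by
  obtain ⟨c, d⟩ := s
  rcases hs with hs | ⟨hc0, hd0, hco, hcd⟩
  · exfalso
    rw [hs, cls_even_right _ (by simp), frac_eq_iff (odd_fan ha hb _) (by simp)] at h
    have h1 : 2 ^ n ∣ b := by
      have : (2 ^ n : ℤ) ∣ b := by simpa using h
      exact_mod_cast this
    have h2 := Nat.le_of_dvd hab.2.1 h1
    have h3 := hab.2.2.2.1
    simp only at h2 h3
    nlinarith
  · simp only at hc0 hd0 hco hcd
    have hco' := Nat.isCoprime_iff_coprime.2 hco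
    rcases parity_cases hco with ⟨hc, hd⟩ | ⟨hc, hd⟩ | ⟨hc, hd⟩
    · rw [cls_even_right _ hd] at h
      exact exists_hits_of_frac_eq hr hrn hab ha hb k c d (by grind) hd hd0 (by omega) hco'
        (by omega) (by omega) h
    · rw [cls_even_left _ hc hd] at h
      refine exists_hits_of_frac_eq hr hrn hab ha hb k _ c (by grind) hc hc0 (by omega) ?_
        (by omega) (by omega) h
      rw [IsCoprime.neg_left_iff]
      have := hco'.symm.add_mul_right_left 1
      rwa [one_mul, add_comm] at this
    · rw [cls_odd_odd _ hc hd] at h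
      refine exists_hits_of_frac_eq hr hrn hab ha hb k _ (c + d) (odd_cast hd).neg (by grind) (by omega)
        (by omega) ?_ (by push_cast; omega) (by omega) (by push_cast; exact h)
      rw [IsCoprime.neg_left_iff]
      have := (hco'.add_mul_right_left 1).symm
      rw [one_mul] at this
      push_cast
      exact this

/-- Walk both fans back `l` steps. If `k = l`, both arrive at sides of `F_r`, equal by size.
Otherwise one more step puts the second fan at `(c - d, d)`, the triangle of `F_r` above `(c, d)`,
and the first fan has a hit before `k`. -/
theorem fan_injective_aux {n r a b c d : ℕ} (hr : 2 ≤ r) (hrn : r * r ≤ 2 ^ n)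
    (hab : IsFareySide r (a, b)) (ha : Odd a) (hb : Even b)
    (hcd : IsFareySide r (c, d)) (hc : Odd c) (hd : Even d) {v k l : ℕ}
    (hv : ∀ k < v, ¬ Hits n r a b k) (hk : k < v) (hlk : l ≤ k)
    (h : frac (2 ^ n) (a + k * b) b = frac (2 ^ n) (c + l * d) d) :
    a = c ∧ b = d ∧ k = l := by
  obtain ⟨j, rfl⟩ := Nat.exists_eq_add_of_le hlk
  have h1 := h
  rw [frac_eq_iff (odd_fan ha hb _) (odd_fan hc hd _)] at h1
  rcases j with _ | j
  · have := side_eq_of_dvd hrn hab hcd (by convert h1 using 1; push_cast; ring)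
    exact ⟨this.1, this.2, rfl⟩
  · exfalso
    obtain ⟨hc0, hd0, hcr, hdr, hco, -⟩ := hcd
    simp only at hc0 hd0 hcr hdr hco
    obtain ⟨k', hk', hh⟩ := exists_hits_of_frac_eq hr hrn hab ha hb j (c - d) d (by grind) hd hd0
      hdr (by
        have := (Nat.isCoprime_iff_coprime.2 hco).add_mul_right_left (-1)
        rwa [neg_one_mul, ← sub_eq_add_neg] at this)
      (by omega) (by omega) (by
        rw [frac_eq_iff (odd_fan ha hb _) (by grind)]
        convert h1 using 1
        push_cast; ring)
    exact hv k' (by omega) hh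

/-- The triangles in the fans above the sides of `F_r` are inequivalent, as long as the fans stop
before running into `F_r`. -/
theorem fan_injective {n r a b c d : ℕ} (hr : 2 ≤ r) (hrn : r * r ≤ 2 ^ n)
    (hab : IsFareySide r (a, b)) (ha : Odd a) (hb : Even b)
    (hcd : IsFareySide r (c, d)) (hc : Odd c) (hd : Even d) {v w k l : ℕ}
    (hv : ∀ k < v, ¬ Hits n r a b k) (hw : ∀ k < w, ¬ Hits n r c d k) (hk : k < v) (hl : l < w)
    (h : frac (2 ^ n) (a + k * b) b = frac (2 ^ n) (c + l * d) d) :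
    a = c ∧ b = d ∧ k = l := by
  rcases le_total l k with hlk | hlk
  · exact fan_injective_aux hr hrn hab ha hb hcd hc hd hv hk hlk h
  · have := fan_injective_aux hr hrn hcd hc hd hab ha hb hw hl hlk h.symm
    exact ⟨this.1.symm, this.2.1.symm, this.2.2.symm⟩

/-! ### Bounding the length of a fan -/

/-- A short vector of the lattice `{(X, Z) | 2 ^ n ∣ a X + b Z}`. -/
theorem exists_lattice_vector {n : ℕ} (hn : 2 ≤ n) {r a b : ℤ} (hb0 : 0 < b) (hbr : b ≤ r)
    (hab : IsCoprime a b) (ha : Odd a) (hb : Even b) :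
    ∃ m X Z : ℤ, a * X + b * Z = m * 2 ^ n ∧ 1 ≤ m ∧ 2 * m ≤ X ∧ X ≤ r ∧ Odd Z ∧ IsCoprime X Z := by
  have h4 : (4 : ℤ) ∣ 2 ^ n := by
    have := pow_dvd_pow (2 : ℤ) hn
    norm_num at this
    exact this
  have hcop : ∀ {X Z u w : ℤ}, Odd Z → u * X + w * Z = 2 ^ n → IsCoprime X Z := by
    intro X Z u w hZ h
    obtain ⟨p, s, hps⟩ : IsCoprime ((2 : ℤ) ^ n) Z := by
      obtain ⟨k, rfl⟩ := hZ
      exact IsCoprime.pow_left ⟨-k, 1, by ring⟩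
    exact ⟨p * u, p * w + s, by linear_combination hps + p * h⟩
  obtain ⟨x, z, hx0, hxb, hxz⟩ : ∃ x z : ℤ, 0 < x ∧ x ≤ b ∧ a * x + b * z = 2 ^ n := by
    obtain ⟨u, w, huw⟩ := hab
    have h1 := Int.emod_add_mul_ediv (2 ^ n * u - 1) b
    have h2 := Int.emod_nonneg (2 ^ n * u - 1) hb0.ne'
    have h3 := Int.emod_lt_of_pos (2 ^ n * u - 1) hb0
    refine ⟨(2 ^ n * u - 1) % b + 1, 2 ^ n * w + a * ((2 ^ n * u - 1) / b), by omega, by omega, ?_⟩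
    linear_combination a * h1 + 2 ^ n * huw
  have hxe : Even x := by
    have h1 : Even (a * x + b * z) := by
      rw [hxz]; exact even_iff_two_dvd.2 ((by norm_num : (2 : ℤ) ∣ 4).trans h4)
    rw [Int.even_add, Int.even_mul, Int.even_mul] at h1
    have := Int.not_even_iff_odd.2 ha
    tauto
  rcases Int.even_or_odd z with hz | hz
  · have hx4 : (4 : ℤ) ∣ x := by
      have h1 : (4 : ℤ) ∣ b * z := by
        obtain ⟨b', rfl⟩ := hb
        obtain ⟨z', rfl⟩ := hz
        exact ⟨b' * z', by ring⟩
      have h2 : (4 : ℤ) ∣ a * x := by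
        rw [show a * x = 2 ^ n - b * z by linarith]; exact dvd_sub h4 h1
      have h3 : IsCoprime (4 : ℤ) a := by
        obtain ⟨k, rfl⟩ := ha
        exact ⟨-(k * (k + 1)), 2 * k + 1, by ring⟩
      exact h3.dvd_of_dvd_mul_left h2
    -- `Z` must be odd, so the even `z` is corrected by `(b, -a)`, which is orthogonal to `(a, b)`.
    -- If adding it makes `X` too large, it is subtracted from the largest multiple of `(x, z)` that
    -- keeps `X ≤ r`.
    by_cases hxbr : x + b ≤ r
    · have hZ : Odd (z - a) := hz.sub_odd ha
      refine ⟨1, x + b, z - a, by linear_combination hxz, le_rfl, by omega, hxbr, hZ, ?_⟩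
      exact hcop (u := z) (w := -x) hZ (by linear_combination hxz)
    · obtain ⟨m, hm⟩ : ∃ m, m = (r + b) / x := ⟨_, rfl⟩
      have h1 := Int.emod_add_mul_ediv (r + b) x
      have h2 := Int.emod_nonneg (r + b) hx0.ne'
      have h3 := Int.emod_lt_of_pos (r + b) hx0
      rw [← hm] at h1
      have hm2 : 2 ≤ m := by
        by_contra hc
        have : x * m ≤ x * 1 := by gcongr; omega
        omega
      have hZ : Odd (m * z + a) := (hz.mul_left m).add_odd ha
      refine ⟨m, x * m - b, m * z + a, by linear_combination m * hxz, by omega, ?_, by omega, hZ, ?_⟩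
      · rcases hm2.eq_or_lt with rfl | hm3
        · obtain ⟨x', rfl⟩ := hx4
          obtain ⟨b', rfl⟩ := hb
          omega
        · obtain ⟨x', rfl⟩ := hx4
          obtain ⟨b', rfl⟩ := hb
          have hx' : 1 ≤ x' := by omega
          rcases hx'.eq_or_lt with rfl | hx2
          · omega
          · have h5 : 4 * x' * 3 ≤ 4 * x' * m := by gcongr; omega
            have h6 : 0 < 4 * x' * m - (b' + b') := by omega
            have h7 : 8 * (4 * x' * m - (b' + b')) ≤ 4 * x' * (4 * x' * m - (b' + b')) := by
              gcongr; omega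
            have h8 : 4 * x' * (2 * m) ≤ 4 * x' * (4 * x' * m - (b' + b')) := by
              refine le_trans ?_ h7
              have : 4 * x' * (2 * m) = 2 * (4 * x' * m) := by ring
              rw [this]; omega
            exact le_of_mul_le_mul_left h8 (by omega)
      · exact hcop (u := -z) (w := x) hZ (by linear_combination hxz)
  · refine ⟨1, x, z, by linear_combination hxz, le_rfl, ?_, hxb.trans hbr, hz, ?_⟩
    · obtain ⟨k, rfl⟩ := hxe; omega
    · exact hcop (u := a) (w := b) hz hxz

/-- The fan above each side `(a, b)` of `F_r` runs into `F_r` before `a + v b` reaches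
`2 ^ (n - 1)`. -/
theorem exists_hits_lt {n r a b : ℕ} (hn : 2 ≤ n) (hr : 2 ≤ r) (hrn : r * r ≤ 2 ^ n)
    (hab : IsFareySide r (a, b)) (ha : Odd a) (hb : Even b) :
    ∃ v, Hits n r a b v ∧ a + v * b < 2 ^ (n - 1) := by
  obtain ⟨ha0, hb0, har, hbr, hco, -⟩ := hab
  simp only at ha0 hb0 har hbr hco
  obtain ⟨m, X, Z, h1, h2, h3, h4, h5, h6⟩ := exists_lattice_vector hn (r := r) (a := a) (b := b)
    (by omega) (by omega) (Nat.isCoprime_iff_coprime.2 hco) (odd_cast ha) (even_cast hb)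
  have hrn' : (r : ℤ) * r ≤ 2 ^ n := by exact_mod_cast hrn
  have hX0 : 0 < X := by omega
  -- Otherwise `a X + b Z ≤ r * r ≤ 2 ^ n` with equality throughout. Then `a = r`, and either `Z =
  -- 0` is even or `a = b = r`.
  have hZ : r - X < Z := by
    by_contra hc
    push Not at hc
    have h7 : (2 : ℤ) ^ n ≤ m * 2 ^ n := le_mul_of_one_le_left (by positivity) h2
    have h8 : (a : ℤ) * X ≤ r * X := by gcongr
    have h9 : (b : ℤ) * Z ≤ b * (r - X) := by gcongr
    have h10 : (b : ℤ) * (r - X) ≤ r * (r - X) := by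
      apply mul_le_mul_of_nonneg_right <;> omega
    have h11 : (a : ℤ) * X = r * X := by linarith
    have h12 : (b : ℤ) * (r - X) = r * (r - X) := by linarith
    have h13 : (b : ℤ) * Z = b * (r - X) := by linarith
    have h14 : (a : ℤ) = r := mul_right_cancel₀ hX0.ne' h11
    have h15 : Z = r - X := mul_left_cancel₀ (by omega) h13
    have h16 : a = r := by exact_mod_cast h14
    rcases eq_or_ne ((r : ℤ) - X) 0 with h17 | h17
    · rw [h15, h17] at h5; simp at h5
    · have h18 : (b : ℤ) = r := mul_right_cancel₀ h17 h12
      have h19 : b = r := by exact_mod_cast h18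
      rw [h16, h19, Nat.coprime_self] at hco
      omega
  -- Reducing `Z` modulo `X` into `(r - X, r]` turns the vector into a side `(X, y)` of `F_r`; the
  -- quotient is the number of fan steps.
  have e1 := Int.emod_add_mul_ediv (Z - (r - X + 1)) X
  have e2 := Int.emod_nonneg (Z - (r - X + 1)) hX0.ne'
  have e3 := Int.emod_lt_of_pos (Z - (r - X + 1)) hX0
  have e4 : 0 ≤ (Z - (r - X + 1)) / X := Int.ediv_nonneg (by omega) hX0.le
  obtain ⟨v, hv⟩ := Int.eq_ofNat_of_zero_le e4
  rw [hv] at e1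
  obtain ⟨x, rfl⟩ := Int.eq_ofNat_of_zero_le hX0.le
  obtain ⟨y, hy⟩ : ∃ y : ℕ, (y : ℤ) = Z - x * v := ⟨(Z - x * v).toNat, by omega⟩
  have hpair : ((a : ℤ) + v * b) * x + b * y = m * 2 ^ n := by rw [hy]; linear_combination h1
  refine ⟨v, ⟨(x, y), ⟨by simp only; omega, by simp only; omega, by simp only; omega,
    by simp only; omega, ?_, by simp only; omega⟩, ?_⟩, ?_⟩
  · simp only
    rw [← Nat.isCoprime_iff_coprime, hy]
    have := h6.add_mul_left_right (-v)
    rwa [mul_neg, ← sub_eq_add_neg] at this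
  · rw [isPaired_iff_int]
    push_cast
    exact ⟨m, by linear_combination hpair⟩
  · have hpow : (2 : ℤ) ^ n = 2 * 2 ^ (n - 1) := by
      rw [← pow_succ', Nat.sub_add_cancel (by omega)]
    have h7 : (0 : ℤ) < b * y := by
      have : 0 < y := by omega
      positivity
    -- Here `2 * m ≤ X` yields the bound by half of `2 ^ n`.
    have h8 : (2 * m) * (2 : ℤ) ^ (n - 1) ≤ x * 2 ^ (n - 1) := by gcongr
    have h9 : (x : ℤ) * (a + v * b) < x * 2 ^ (n - 1) := by
      rw [hpow] at hpair; linarith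
    have h10 := lt_of_mul_lt_mul_left h9 hX0.le
    exact_mod_cast h10

theorem IsFareySide.swap {r a b : ℕ} (h : IsFareySide r (a, b)) : IsFareySide r (b, a) := by
  obtain ⟨h1, h2, h3, h4, h5, h6⟩ := h
  exact ⟨h2, h1, h4, h3, h5.symm, by simp only at h6 ⊢; omega⟩

theorem parity_of_paired {n : ℕ} (hn : 1 ≤ n) {a b x y : ℕ} (ha : Odd a) (hb : Even b)
    (hxy : Nat.Coprime x y) (h : IsPaired (2 ^ n) (a, b) (x, y)) : Even x ∧ Odd y := by
  have h2 : 2 ∣ a * x + b * y := (dvd_pow_self 2 (by omega)).trans h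
  rw [← even_iff_two_dvd, Nat.even_add, Nat.even_mul, Nat.even_mul] at h2
  have := parity_cases hxy
  grind

/-- The first side that is paired with a pair in the fan above `(a, b)` bounds the fan on the
other end. -/
theorem add_mul_lt_of_first_hit {n r a b x y v : ℕ} (hn : 2 ≤ n) (hr : 2 ≤ r)
    (hrn : r * r ≤ 2 ^ n) (hab : IsFareySide r (a, b)) (ha : Odd a) (hb : Even b)
    (hv : ∀ k < v, ¬ Hits n r a b k) (hxy : IsFareySide r (x, y))
    (h : IsPaired (2 ^ n) (a + v * b, b) (x, y)) : a + v * b < 2 ^ (n - 1) ∧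
      y + v * x < 2 ^ (n - 1) := by
  obtain ⟨hx, hy⟩ := parity_of_paired (by omega) (odd_fan_nat ha hb v) hb hxy.2.2.2.2.1 h
  constructor
  · obtain ⟨w, hw, hlt⟩ := exists_hits_lt hn hr hrn hab ha hb
    have hvw : v ≤ w := by
      by_contra hc
      exact hv w (by omega) hw
    have : v * b ≤ w * b := Nat.mul_le_mul_right _ hvw
    omega
  -- The same bound for the reversed fan above `(y, x)`. A hit there after `w < v` steps would give
  -- a hit of the original fan within `v - w - 1` steps.
  · obtain ⟨w, ⟨⟨c, d⟩, hcd, hp⟩, hlt⟩ := exists_hits_lt hn hr hrn hxy.swap hy hx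
    have hvw : v ≤ w := by
      by_contra hc
      obtain ⟨j, rfl⟩ := Nat.exists_eq_add_of_lt (not_le.1 hc)
      obtain ⟨hce, hdo⟩ := parity_of_paired (by omega) (odd_fan_nat hy hx w) hx hcd.2.2.2.2.1 hp
      rw [isPaired_iff_int] at h hp
      push_cast at h hp
      -- both `(d, c)` and `(a + (v - w) b, b)` are orthogonal to `(x, y + w x)`
      have h1 : (2 ^ n : ℤ) ∣ (y + w * x) * ((a + (j + 1) * b) * c - d * b) := by
        obtain ⟨α, hα⟩ := h
        obtain ⟨β, hβ⟩ := hp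
        refine ⟨β * (a + (j + 1) * b) - α * d, ?_⟩
        linear_combination (a + (j + 1) * b : ℤ) * hβ - (d : ℤ) * hα
      have h2 : (2 ^ n : ℤ) ∣ (a + (j + 1) * b) * c - d * b := by
        refine IsCoprime.dvd_of_dvd_mul_left ?_ h1
        obtain ⟨k, hk⟩ : Odd (y + w * x : ℤ) := odd_fan hy hx _
        rw [hk]
        exact IsCoprime.pow_left ⟨-k, 1, by ring⟩
      obtain ⟨hc0, hd0, hcr, hdr, hco, -⟩ := hcd
      simp only at hc0 hd0 hcr hdr hco
      obtain ⟨k', hk', hh⟩ := exists_hits_of_frac_eq hr hrn hab ha hb j (d - c) c (by grind) hce hc0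
        hcr (by
          have := (Nat.isCoprime_iff_coprime.2 hco.symm).add_mul_right_left (-1)
          rwa [neg_one_mul, ← sub_eq_add_neg] at this)
        (by omega) (by omega) (by
          rw [frac_eq_iff (odd_fan ha hb _) (by grind)]
          convert h2 using 1
          ring)
      exact hv k' (by omega) hh
    have : v * x ≤ w * x := Nat.mul_le_mul_right _ hvw
    omega

/-! ### A fan up to its first hit, divided between its two ends -/

/-- In the fan above the side `s` of `F_r`, the first pair that is paired with a side of `F_r` is
`(s.1 + v s.2, s.2)`, and it is paired with `t`. -/
structure IsFirstHit (n r : ℕ) (s : ℕ × ℕ) (v : ℕ) (t : ℕ × ℕ) : Prop where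
  side : IsFareySide r s
  odd : Odd s.1
  even : Even s.2
  pos : 1 ≤ v
  target_side : IsFareySide r t
  paired : IsPaired (2 ^ n) (s.1 + v * s.2, s.2) t
  first : ∀ k < v, ¬ Hits n r s.1 s.2 k

/-- The pair that is split in the `k`-th triangle of the fan above `s`: the first half of the fan
is attached to `s`, the second half to `t`. -/
def fanNode (s : ℕ × ℕ) (v : ℕ) (t : ℕ × ℕ) (k : ℕ) : ℕ × ℕ :=
  if k < (v + 1) / 2 then (s.1 + k * s.2, s.2) else (t.1, t.2 + (v - 1 - k) * t.1)

namespace IsFirstHit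

variable {n r v : ℕ} {s t : ℕ × ℕ}

theorem target_parity (h : IsFirstHit n r s v t) (hn : 1 ≤ n) : Even t.1 ∧ Odd t.2 :=
  parity_of_paired hn (odd_fan_nat h.odd h.even v) h.even h.target_side.2.2.2.2.1 h.paired

/-- The identity `(a + v b) x + b y = (a + k b) x + b (y + (v - k) x)` matches the triangle `k`
steps from `s` with the one `v - 1 - k` steps from `t`. -/
theorem cls_fanNode (h : IsFirstHit n r s v t) (hn : 1 ≤ n) {k : ℕ} (hk : k < v) :
    cls (2 ^ n) (fanNode s v t k) = frac (2 ^ n) (s.1 + k * s.2) s.2 := by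
  obtain ⟨hx, hy⟩ := h.target_parity hn
  have hp := h.paired
  have ha := h.odd
  have hb := h.even
  obtain ⟨a, b⟩ := s
  obtain ⟨x, y⟩ := t
  unfold fanNode
  simp only at *
  split_ifs with hlt
  · rw [cls_even_right _ hb]
    push_cast
    rfl
  · obtain ⟨j, hj⟩ : ∃ j, v = k + 1 + j := Nat.exists_eq_add_of_le hk
    have hj' : v - 1 - k = j := by omega
    have hyj : Odd (y + j * x) := odd_fan_nat hy hx j
    rw [hj', cls_even_left _ hx hyj,
      frac_eq_iff ((even_cast hx).add_odd (odd_cast hyj)).neg (odd_fan ha hb _), ← dvd_neg]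
    rw [isPaired_iff_int, hj] at hp
    obtain ⟨m, hm⟩ := hp
    refine ⟨m, ?_⟩
    push_cast at hm ⊢
    linear_combination hm

theorem cls_last (h : IsFirstHit n r s v t) (hn : 1 ≤ n) :
    frac (2 ^ n) (s.1 + v * s.2) s.2 = cls (2 ^ n) (parent t) := by
  have h1 := (isPaired_iff hn (s := (s.1 + v * s.2, s.2)) (by
    simpa using h.side.2.2.2.2.1) h.target_side.2.2.2.2.1
    h.target_side.1 h.target_side.2.1).1 h.paired
  rw [← h1.2.2, cls_even_right _ h.even]
  push_cast
  rfl

theorem fanNode_add_le (h : IsFirstHit n r s v t) (hn : 2 ≤ n) (hr : 2 ≤ r)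
    (hrn : r * r ≤ 2 ^ n) {k : ℕ} (hk : k < v) :
    (fanNode s v t k).1 + (fanNode s v t k).2 ≤ 2 ^ (n - 1) := by
  obtain ⟨h1, h2⟩ := add_mul_lt_of_first_hit hn hr hrn h.side h.odd h.even h.first h.target_side
    h.paired
  unfold fanNode
  split_ifs with hlt
  · have : (k + 1) * s.2 ≤ v * s.2 := Nat.mul_le_mul_right _ hk
    simp only
    rw [add_mul] at this
    omega
  · have : (v - 1 - k + 1) * t.1 ≤ v * t.1 := Nat.mul_le_mul_right _ (by omega)
    simp only
    rw [add_mul] at this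
    omega

/-- The outer sides of the fan above `s` with both entries odd have small sum. -/
theorem child_fanNode_add_lt (h : IsFirstHit n r s v t) (hn : 2 ≤ n) (hr : 2 ≤ r)
    (hrn : r * r ≤ 2 ^ n) {k : ℕ} (hk : k < v) {p : ℕ × ℕ} (hp : parent p = fanNode s v t k)
    (hp1 : Odd p.1) (hp2 : Odd p.2) : p.1 + p.2 < 2 ^ (n - 1) + r := by
  obtain ⟨h1, h2⟩ := add_mul_lt_of_first_hit hn hr hrn h.side h.odd h.even h.first h.target_side
    h.paired
  obtain ⟨hx, hy⟩ := h.target_parity (by omega)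
  have hodd := h.odd
  have heven := h.even
  have hs1 := h.side.2.2.1
  have ht2 := h.target_side.2.2.2.1
  unfold fanNode at hp
  split_ifs at hp with hlt
  -- This is the gain from halving: `2 * k + 1 ≤ v` bounds the sum `2 a + (2 k + 1) b` by `a + (a +
  -- v b)`.
  · have : (2 * k + 1) * s.2 ≤ v * s.2 := Nat.mul_le_mul_right _ (by omega)
    have h3 : (2 * k + 1) * s.2 = 2 * (k * s.2) + s.2 := by ring
    rcases eq_of_parent hp with rfl | rfl
    · simp only; omega
    · simp only at hp2; grind
  · have : (2 * (v - 1 - k) + 1) * t.1 ≤ v * t.1 := Nat.mul_le_mul_right _ (by omega)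
    have h3 : (2 * (v - 1 - k) + 1) * t.1 = 2 * ((v - 1 - k) * t.1) + t.1 := by ring
    rcases eq_of_parent hp with rfl | rfl
    · simp only at hp1; grind
    · simp only; omega

theorem unique {s' t' : ℕ × ℕ} {v' k k' : ℕ} (h : IsFirstHit n r s v t)
    (h' : IsFirstHit n r s' v' t') (hr : 2 ≤ r) (hrn : r * r ≤ 2 ^ n) (hk : k < v) (hk' : k' < v')
    (heq : frac (2 ^ n) (s.1 + k * s.2) s.2 = frac (2 ^ n) (s'.1 + k' * s'.2) s'.2) :
    s = s' ∧ k = k' := by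
  have := fan_injective hr hrn h.side h.odd h.even h'.side h'.odd h'.even h.first h'.first hk hk' heq
  exact ⟨Prod.ext this.1 this.2.1, this.2.2⟩

/-- Fans with a common target reach the same class, so one step earlier they would share a triangle.
-/
theorem eq_of_target_eq {s' : ℕ × ℕ} {v' : ℕ} (h : IsFirstHit n r s v t)
    (h' : IsFirstHit n r s' v' t) (hn : 1 ≤ n) (hr : 2 ≤ r) (hrn : r * r ≤ 2 ^ n) : s = s' := by
  have h1 := (h.cls_last hn).trans (h'.cls_last hn).symm
  obtain ⟨w, rfl⟩ := Nat.exists_eq_add_of_le h.pos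
  obtain ⟨w', rfl⟩ := Nat.exists_eq_add_of_le h'.pos
  refine (h.unique h' hr hrn (k := w) (k' := w') (by omega) (by omega) ?_).1
  rw [frac_eq_iff (odd_fan h.odd h.even _) (odd_fan h'.odd h'.even _)] at h1 ⊢
  convert h1 using 1
  push_cast; ring

end IsFirstHit

/-- `exists_hits_lt` puts a hit within the range of the search. Freeness excludes a hit at `0`, so
the first success from `1` on is the first hit of the fan. -/
theorem exists_chainSearch {n r : ℕ} (hn : 2 ≤ n) (hr : 2 ≤ r) (hrn : r * r ≤ 2 ^ n)
    {s : ℕ × ℕ} (hs : IsFareySide r s) (hs1 : Odd s.1) (hs2 : Even s.2)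
    (hfree : ∀ t, IsFareySide r t → ¬ IsPaired (2 ^ n) s t) :
    ∃ v t, chainSearch (2 ^ n) (fareyF r) s = some (v, t) ∧ IsFirstHit n r s v t := by
  have h0 : ¬ Hits n r s.1 s.2 0 := by
    rintro ⟨t, ht, hp⟩
    rw [zero_mul, add_zero] at hp
    exact hfree t ht hp
  cases hc : chainSearch (2 ^ n) (fareyF r) s with
  | none =>
    exfalso
    obtain ⟨v, ⟨t, ht, hp⟩, hlt⟩ := exists_hits_lt hn hr hrn hs hs1 hs2
    have hv0 : v ≠ 0 := by rintro rfl; exact h0 ⟨t, ht, hp⟩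
    have hvN : v ≤ 2 ^ n := by
      have h1 : v * 1 ≤ v * s.2 := Nat.mul_le_mul_left _ hs.2.1
      have h2 : 2 ^ (n - 1) ≤ 2 ^ n := Nat.pow_le_pow_right (by norm_num) (by omega)
      omega
    simp only [chainSearch, List.findSome?_eq_none_iff, Option.map_eq_none_iff,
      List.find?_eq_none] at hc
    exact hc v (by rw [List.mem_range'_1]; omega) t ((mem_sides_fareyF (by omega)).2 ht)
      (by simpa using hp)
  | some q =>
    obtain ⟨v, t⟩ := q
    refine ⟨v, t, rfl, ?_⟩
    simp only [chainSearch, List.findSome?_eq_some_iff, Option.map_eq_some_iff,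
      Option.map_eq_none_iff, List.find?_eq_none] at hc
    obtain ⟨l₁, w, l₂, hl, ⟨t', ht', hwt⟩, hnone⟩ := hc
    simp only [Prod.mk.injEq] at hwt
    obtain ⟨rfl, rfl⟩ := hwt
    have hmem := List.mem_of_find?_eq_some ht'
    have hpair := List.find?_some ht'
    have hw : w ∈ List.range' 1 (2 ^ n) := by rw [hl]; simp
    rw [List.mem_range'_1] at hw
    refine ⟨hs, hs1, hs2, hw.1, (mem_sides_fareyF (by omega)).1 hmem, by simpa using hpair, ?_⟩
    rintro k hk ⟨t, ht, hp⟩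
    rcases Nat.eq_zero_or_pos k with rfl | hk0
    · exact h0 ⟨t, ht, hp⟩
    · have hkm : k ∈ List.range' 1 (2 ^ n) := by rw [List.mem_range'_1]; omega
      have hsorted : (List.range' 1 (2 ^ n)).Pairwise (· < ·) := List.pairwise_lt_range'
      rw [hl] at hkm hsorted
      rw [List.pairwise_append, List.pairwise_cons] at hsorted
      rw [List.mem_append, List.mem_cons] at hkm
      rcases hkm with hkm | rfl | hkm
      · exact hnone k hkm t ((mem_sides_fareyF (by omega)).2 ht) (by simpa using hp)
      · omega
      · have := hsorted.2.1.1 k hkm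
        omega

/-! ### Insertion of all fans, and inequivalence of the resulting triangles -/

/-- The triangles of `F_r` and of the fans above the sides `s` in the list `l`. -/
def fanNodes (r : ℕ) (V : ℕ × ℕ → ℕ) (t : ℕ × ℕ → ℕ × ℕ) (l : List (ℕ × ℕ)) : Set (ℕ × ℕ) :=
  fareyNodes r ∪ {p | ∃ s ∈ l, ∃ k < V s, p = fanNode s (V s) (t s) k}

section fans

variable {n r : ℕ} {V : ℕ × ℕ → ℕ} {t : ℕ × ℕ → ℕ × ℕ} {l : List (ℕ × ℕ)}

theorem IsFareySide.notMem_fareyNodes {s : ℕ × ℕ} (h : IsFareySide r s) : s ∉ fareyNodes r := by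
  rintro (rfl | h')
  · exact absurd h.2.1 (by simp)
  · have := h.2.2.2.2.2
    omega

theorem IsFareySide.parent_mem {s : ℕ × ℕ} (h : IsFareySide r s) : parent s ∈ fareyNodes r := by
  have hr : 1 ≤ r := h.1.trans h.2.2.1
  exact ((fareyF_triangulates r).mem_sides.1 ((mem_sides_fareyF hr).2 h)).2.2.2

theorem isFareySide_of_parent_mem (hr : 1 ≤ r) {s : ℕ × ℕ} (h1 : 1 ≤ s.1) (h2 : 1 ≤ s.2)
    (h : s ∉ fareyNodes r) (hp : parent s ∈ fareyNodes r) : IsFareySide r s :=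
  (mem_sides_fareyF hr).1 ((fareyF_triangulates r).mem_sides.2 ⟨h, h1, h2, hp⟩)

/-- A side of `F_r` that is split in a fan is one of the two end sides of that fan. -/
theorem eq_of_fanNode_isFareySide {s t p : ℕ × ℕ} {v k : ℕ} (h : IsFirstHit n r s v t) (hk : k < v)
    (hp : IsFareySide r p) (he : p = fanNode s v t k) : p = s ∨ p = t := by
  unfold fanNode at he
  have hs := h.side
  have ht := h.target_side
  split_ifs at he with hlt
  · left
    have : k = 0 := by
      by_contra hk0
      have h1 := hp.2.2.1
      rw [he] at h1
      simp only at h1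
      have h2 : 1 * s.2 ≤ k * s.2 := Nat.mul_le_mul_right _ (by omega)
      have h3 := hs.2.2.2.2.2
      omega
    subst this
    simpa using he
  · right
    have : v - 1 - k = 0 := by
      by_contra hk0
      have h1 := hp.2.2.2.1
      rw [he] at h1
      simp only at h1
      have h2 : 1 * t.1 ≤ (v - 1 - k) * t.1 := Nat.mul_le_mul_right _ (by omega)
      have h3 := ht.2.2.2.2.2
      omega
    rw [this] at he
    simpa using he

/-- The next fan finds both its ends unsplit: parity of the first entry separates free sides from
targets, and distinct free sides have distinct targets by `eq_of_target_eq`. -/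
theorem foldlM_insertChain (hn : 1 ≤ n) (hr : 2 ≤ r) (hrn : r * r ≤ 2 ^ n) (l : List (ℕ × ℕ)) :
    ∀ done : List (ℕ × ℕ), (done ++ l).Nodup →
    (∀ s ∈ done ++ l, chainSearch (2 ^ n) (fareyF r) s = some (V s, t s) ∧
      IsFirstHit n r s (V s) (t s)) →
    ∀ L, Triangulates L (fanNodes r V t done) → Refines (fareyF r) L →
    ∃ L', l.foldlM (insertChain (2 ^ n) (fareyF r)) L = some L' ∧
      Triangulates L' (fanNodes r V t (done ++ l)) ∧ Refines (fareyF r) L' := by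
  induction l with
  | nil =>
    intro done _ _ L hL href
    exact ⟨L, rfl, by simpa using hL, href⟩
  | cons s l ih =>
    intro done hnd hfan L hL href
    obtain ⟨hsearch, hs⟩ := hfan s (by simp)
    have hts := hs.target_parity hn
    have hsd : s ∉ done := by
      rw [List.nodup_append] at hnd
      exact fun hc => hnd.2.2 s hc s (by simp) rfl
    have hsL : s ∈ sides L := by
      rw [hL.mem_sides]
      refine ⟨?_, hs.side.1, hs.side.2.1, Or.inl hs.side.parent_mem⟩
      rintro (h | ⟨s', hs', k, hk, he⟩)
      · exact hs.side.notMem_fareyNodes h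
      · have hf := (hfan s' (by simp [hs'])).2
        have ht' := hf.target_parity hn
        rcases eq_of_fanNode_isFareySide hf hk hs.side he with h | h
        · exact hsd (h ▸ hs')
        · have := hs.odd
          rw [h] at this
          exact (Nat.not_odd_iff_even.2 ht'.1) this
    have htL : t s ∈ sides L := by
      rw [hL.mem_sides]
      refine ⟨?_, hs.target_side.1, hs.target_side.2.1, Or.inl hs.target_side.parent_mem⟩
      rintro (h | ⟨s', hs', k, hk, he⟩)
      · exact hs.target_side.notMem_fareyNodes h
      · have hf := (hfan s' (by simp [hs'])).2
        rcases eq_of_fanNode_isFareySide hf hk hs.target_side he with h | h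
        · have := hf.odd
          rw [← h] at this
          exact (Nat.not_odd_iff_even.2 hts.1) this
        · rw [h] at hs
          exact hsd (hs.eq_of_target_eq hf hn hr hrn ▸ hs')
    obtain ⟨h1, h2⟩ := hL.insertInSide_right (x := (t s).1) (y := (t s).2) htL (V s / 2)
    have hsL' : (s.1, s.2) ∈ sides (insertInSide ((t s).1, (t s).2)
        ((List.range' 1 (V s / 2)).map fun k => (t s).2 + k * (t s).1).reverse L) := by
      rw [h1.mem_sides]
      rw [hL.mem_sides] at hsL
      refine ⟨?_, hsL.2.1, hsL.2.2.1, Or.inl hsL.2.2.2⟩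
      rintro (h | ⟨k, -, h⟩)
      · exact hsL.1 h
      · have := hs.odd
        simp only [Prod.mk.injEq] at h
        rw [h.1] at this
        exact (Nat.not_odd_iff_even.2 hts.1) this
    obtain ⟨h3, h4⟩ := h1.insertInSide_left hsL' ((V s + 1) / 2)
    have hnodes : fanNodes r V t done ∪ {p | ∃ k < V s / 2, p = ((t s).1, (t s).2 + k * (t s).1)} ∪
        {p | ∃ k < (V s + 1) / 2, p = (s.1 + k * s.2, s.2)} = fanNodes r V t (done ++ [s]) := by
      ext p
      simp only [fanNodes, Set.mem_union, Set.mem_ofPred_eq, List.mem_append, List.mem_singleton]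
      constructor
      · rintro (((h | ⟨s', hs', h⟩) | ⟨k, hk, rfl⟩) | ⟨k, hk, rfl⟩)
        · exact Or.inl h
        · exact Or.inr ⟨s', Or.inl hs', h⟩
        · refine Or.inr ⟨s, Or.inr rfl, V s - 1 - k, by omega, ?_⟩
          rw [fanNode, if_neg (by omega), show V s - 1 - (V s - 1 - k) = k by omega]
        · refine Or.inr ⟨s, Or.inr rfl, k, by omega, ?_⟩
          rw [fanNode, if_pos hk]
      · rintro (h | ⟨s', hs' | rfl, k, hk, h⟩)
        · exact Or.inl (Or.inl (Or.inl h))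
        · exact Or.inl (Or.inl (Or.inr ⟨s', hs', k, hk, h⟩))
        · rw [fanNode] at h
          split_ifs at h with hlt
          · exact Or.inr ⟨k, hlt, h⟩
          · exact Or.inl (Or.inr ⟨V s' - 1 - k, by omega, h⟩)
    rw [hnodes] at h3
    obtain ⟨L', hL', h5, h6⟩ := ih (done ++ [s]) (by simpa using hnd) (by simpa using hfan) _ h3
      ((href.trans h2).trans h4)
    refine ⟨L', ?_, by simpa using h5, h6⟩
    rw [List.foldlM_cons, insertChain, hsearch]
    exact hL'

theorem odd_neg_add {a b : ℕ} (ha : Even a) (hb : Odd b) : Odd (-(a + b) : ℤ) :=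
  ((even_cast ha).add_odd (odd_cast hb)).neg

/-- Distinct triangles of `F_r` are inequivalent. -/
theorem injOn_fareyNodes (hr : 2 ≤ r) (hrn : r * r ≤ 2 ^ n) :
    Set.InjOn (cls (2 ^ n)) (fareyNodes r) := by
  have hdata : ∀ a b : ℕ, (a, b) ∈ fareyNodes r → 1 ≤ a ∧ a ≤ r ∧ b < r ∧ a + b ≤ r ∧
      Nat.Coprime a b := by
    rintro a b (h | ⟨h1, h2, h3, h4⟩)
    · simp only [Prod.mk.injEq] at h
      obtain ⟨rfl, rfl⟩ := h
      simp; omega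
    · simp only at h1 h2 h3 h4
      omega
  have hpos : ∀ {z : ℤ}, (2 ^ n : ℤ) ∣ z → 0 < z → z < r * r → False := by
    intro z h h1 h2
    have h3 := Int.le_of_dvd h1 h
    have h4 : (r : ℤ) * r ≤ 2 ^ n := by exact_mod_cast hrn
    linarith
  -- edges of different parity types
  have key : ∀ a b c d : ℕ, (a, b) ∈ fareyNodes r → (c, d) ∈ fareyNodes r →
      ((Odd a ∧ Even b ∧ Odd c ∧ Odd d) ∨ (Odd a ∧ Even b ∧ Even c ∧ Odd d) ∨
        (Odd a ∧ Odd b ∧ Even c ∧ Odd d)) → cls (2 ^ n) (a, b) ≠ cls (2 ^ n) (c, d) := by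
    intro a b c d hs ht htype h
    obtain ⟨ha, har, hbr, hab, -⟩ := hdata a b hs
    obtain ⟨hc, hcr, hdr, hcd, -⟩ := hdata c d ht
    -- For different parity types all terms of the cross product have the same sign, so it lies
    -- strictly between `0` and `r * r`.
    have e1 : (a : ℤ) * (c + d) ≤ a * r := by
      apply mul_le_mul_of_nonneg_left <;> omega
    have e2 : (r : ℤ) * (a + b) ≤ r * r := by
      apply mul_le_mul_of_nonneg_left <;> omega
    have e3 : (0 : ℤ) < a * (c + d) := by positivity
    have e4 : (0 : ℤ) < a * c := by positivity
    rcases htype with ⟨h1, h2, h3, h4⟩ | ⟨h1, h2, h3, h4⟩ | ⟨h1, h2, h3, h4⟩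
    · rw [cls_even_right _ h2, cls_odd_odd _ h3 h4, frac_eq_iff (odd_cast h1) (odd_cast h4).neg] at h
      refine hpos h ?_ ?_
      · have : (0 : ℤ) ≤ d * b := by positivity
        linarith
      · rcases Nat.eq_zero_or_pos b with rfl | hb
        · have : a * (c + d) < r * r := by
            calc a * (c + d) ≤ a * r := Nat.mul_le_mul_left _ hcd
              _ < r * r := by
                have : a = 1 := by simpa using (hdata a 0 hs).2.2.2.2
                subst this; exact Nat.mul_lt_mul_of_pos_right (by omega) (by omega)
          zify at this
          push_cast
          linarith
        · have : (d : ℤ) * b < r * b := by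
            apply mul_lt_mul_of_pos_right <;> omega
          linarith
    · rw [cls_even_right _ h2, cls_even_left _ h3 h4, frac_eq_iff (odd_cast h1) (odd_neg_add h3 h4)] at h
      refine hpos h ?_ ?_
      · have : (0 : ℤ) ≤ (c + d) * b := by positivity
        linarith
      · have h5 : (c + d : ℤ) * b ≤ r * b := by
          apply mul_le_mul_of_nonneg_right <;> omega
        have h6 : c ≠ r := by
          rintro rfl
          have := h4.pos
          omega
        have h7 : (a : ℤ) * c < a * r := by
          apply mul_lt_mul_of_pos_left <;> omega
        linarith
    · rw [cls_odd_odd _ h1 h2, cls_even_left _ h3 h4,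
        frac_eq_iff (odd_cast h2).neg (odd_neg_add h3 h4)] at h
      refine hpos h ?_ ?_
      · have : (0 : ℤ) ≤ d * b := by positivity
        linarith
      · have h5 : (d : ℤ) * b < r * b := by
          have := h2.pos
          apply mul_lt_mul_of_pos_right <;> omega
        linarith
  have same : ∀ a b c d : ℕ, (a, b) ∈ fareyNodes r → (c, d) ∈ fareyNodes r →
      (2 ^ n : ℤ) ∣ a * d - c * b → a = c ∧ b = d := by
    intro a b c d hs ht h
    obtain ⟨ha, har, hbr, hab, hco⟩ := hdata a b hs
    obtain ⟨hc, hcr, hdr, hcd, hco'⟩ := hdata c d ht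
    have h1 : a * d < r * r := Nat.mul_lt_mul_of_le_of_lt har hdr (by omega)
    have h2 : c * b < r * r := Nat.mul_lt_mul_of_le_of_lt hcr hbr (by omega)
    have h3 : (0 : ℤ) ≤ a * d := by positivity
    have h4 : (0 : ℤ) ≤ c * b := by positivity
    have h0 : (a * d - c * b : ℤ) = 0 := by
      apply Int.eq_zero_of_abs_lt_dvd h
      zify at h1 h2 hrn
      rw [abs_lt]
      constructor <;> linarith
    exact eq_of_cross ha hco hco' (by zify; linarith)
  rintro ⟨a, b⟩ hs ⟨c, d⟩ ht h
  rcases parity_cases (hdata a b hs).2.2.2.2 with ⟨h1, h2⟩ | ⟨h1, h2⟩ | ⟨h1, h2⟩ <;>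
    rcases parity_cases (hdata c d ht).2.2.2.2 with ⟨h3, h4⟩ | ⟨h3, h4⟩ | ⟨h3, h4⟩
  · rw [cls_even_right _ h2, cls_even_right _ h4, frac_eq_iff (odd_cast h1) (odd_cast h3)] at h
    exact Prod.ext_iff.2 (same _ _ _ _ hs ht h)
  · exact absurd h (key _ _ _ _ hs ht (by tauto))
  · exact absurd h (key _ _ _ _ hs ht (by tauto))
  · exact absurd h.symm (key _ _ _ _ ht hs (by tauto))
  · rw [cls_even_left _ h1 h2, cls_even_left _ h3 h4,
      frac_eq_iff (odd_neg_add h1 h2) (odd_neg_add h3 h4)] at h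
    refine Prod.ext_iff.2 (same _ _ _ _ hs ht ?_)
    convert h using 1
    ring
  · exact absurd h.symm (key _ _ _ _ ht hs (by tauto))
  · exact absurd h.symm (key _ _ _ _ ht hs (by tauto))
  · exact absurd h (key _ _ _ _ hs ht (by tauto))
  · rw [cls_odd_odd _ h1 h2, cls_odd_odd _ h3 h4,
      frac_eq_iff (odd_cast h2).neg (odd_cast h4).neg] at h
    refine Prod.ext_iff.2 (same _ _ _ _ hs ht ?_)
    convert h using 1
    ring

theorem injOn_fanNodes (hn : 1 ≤ n) (hr : 2 ≤ r) (hrn : r * r ≤ 2 ^ n)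
    (hl : ∀ s ∈ l, IsFirstHit n r s (V s) (t s)) :
    Set.InjOn (cls (2 ^ n)) (fanNodes r V t l) := by
  have key : ∀ p ∈ fareyNodes r, ∀ s ∈ l, ∀ k < V s,
      cls (2 ^ n) p ≠ cls (2 ^ n) (fanNode s (V s) (t s) k) := by
    intro p hp s hs k hk h
    have hf := hl s hs
    rw [hf.cls_fanNode hn hk] at h
    obtain ⟨k', hk', hh⟩ := exists_hits_of_cls_eq (a := s.1) (b := s.2) hr hrn hf.side hf.odd hf.even
      hp h.symm
    exact hf.first k' (by omega) hh
  rintro p (hp | ⟨s, hs, k, hk, rfl⟩) q (hq | ⟨s', hs', k', hk', rfl⟩) h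
  · exact injOn_fareyNodes hr hrn hp hq h
  · exact absurd h (key p hp s' hs' k' hk')
  · exact absurd h.symm (key q hq s hs k hk)
  · rw [(hl s hs).cls_fanNode hn hk, (hl s' hs').cls_fanNode hn hk'] at h
    obtain ⟨rfl, rfl⟩ := (hl s hs).unique (hl s' hs') hr hrn hk hk' h
    rfl

end fans

/-! ### The final insertions into odd sides -/

section last

variable {n r h : ℕ} {V : ℕ × ℕ → ℕ} {t : ℕ × ℕ → ℕ × ℕ} {l : List (ℕ × ℕ)} {S : List ℕ}

/-- The sides of `S` that are split in the last step of the algorithm. -/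
def lastNodes (h : ℕ) (S : List ℕ) : Set (ℕ × ℕ) :=
  {p | p ∈ sides S ∧ Odd p.1 ∧ Odd p.2 ∧ 2 ^ h ∣ p.1 + p.2}

/-- Otherwise `b = r = 2 ^ h` and `b * b = 2 ^ n`. Then `a b + b (b - a) = 2 ^ n` pairs `(a, b)`
with the side `(b, b - a)`. -/
theorem IsFirstHit.not_dvd {s t : ℕ × ℕ} {v : ℕ} (hs : IsFirstHit n r s v t) (hr : 2 ≤ r)
    (hrn : r * r ≤ 2 ^ n) (hrh : r ≤ 2 ^ h) (hnh : n ≤ 2 * h) : ¬ 2 ^ h ∣ s.2 := by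
  intro hd
  have hside := hs.side
  have hfirst := hs.first 0 hs.pos
  obtain ⟨a, b⟩ := s
  obtain ⟨ha0, hb0, har, hbr, hco, -⟩ := hside
  simp only at ha0 hb0 har hbr hco hd hfirst
  have h1 := Nat.le_of_dvd hb0 hd
  have h2 : b = r := by omega
  have h3 : r = 2 ^ h := by omega
  subst h2
  have h4 : b * b = 2 ^ n := by
    refine le_antisymm hrn ?_
    rw [h3, ← pow_add]
    exact Nat.pow_le_pow_right (by norm_num) (by omega)
  have hne : a ≠ b := by
    rintro rfl
    rw [Nat.coprime_self] at hco
    omega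
  refine hfirst ⟨(b, b - a), ⟨hb0, by simp only; omega, le_rfl, Nat.sub_le _ _, ?_,
    by simp only; omega⟩, ?_⟩
  · exact (Nat.coprime_self_sub_right har).2 hco.symm
  · rw [zero_mul, add_zero]
    unfold IsPaired
    simp only
    rw [mul_comm a b, ← mul_add, Nat.add_sub_cancel' har, h4]

/-- The even vertex of the triangle above `(x, y)` is `|y - x|`. In `F_r` it is positive and less
than `2 ^ h`; in a fan it is a unit times `s.2` modulo `2 ^ n`. -/
theorem not_dvd_sub_of_mem_sides (hn : 1 ≤ n) (hr : 2 ≤ r) (hrn : r * r ≤ 2 ^ n) (hrh : r ≤ 2 ^ h)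
    (hnh : n ≤ 2 * h) (hhn : h ≤ n) (hS : Triangulates S (fanNodes r V t l))
    (hl : ∀ s ∈ l, IsFirstHit n r s (V s) (t s)) {x y : ℕ} (hs : (x, y) ∈ sides S) (hx : Odd x)
    (hy : Odd y) : ¬ (2 ^ h : ℤ) ∣ y - x := by
  intro hdvd
  obtain ⟨hI, hx0, hy0, hpar⟩ := hS.mem_sides.1 hs
  rcases hpar with hpar | ⟨s, hsl, k, hk, hpar⟩
  · obtain ⟨-, -, hxr, hyr, hco, hxy⟩ := isFareySide_of_parent_mem (by omega) hx0 hy0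
      (fun hc => hI (Or.inl hc)) hpar
    simp only at hx0 hy0 hxr hyr hco hxy
    have h0 := Int.eq_zero_of_abs_lt_dvd hdvd (by
      have : (r : ℤ) ≤ 2 ^ h := by exact_mod_cast hrh
      rw [abs_lt]; constructor <;> linarith)
    have h1 : x = y := by omega
    rw [h1, Nat.coprime_self] at hco
    omega
  · have hf := hl s hsl
    have h1 := hf.cls_fanNode hn hk
    rw [← hpar, cls_parent_odd_odd hx0 hy0 hx hy,
      frac_eq_iff (odd_cast hx) (odd_fan hf.odd hf.even _)] at h1
    have h2 : (2 ^ h : ℤ) ∣ x * s.2 := by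
      have h3 := (pow_dvd_pow (2 : ℤ) hhn).trans h1
      rw [← dvd_sub_left (hdvd.mul_left (s.1 + k * s.2 : ℤ))]
      exact h3
    have h3 : (2 ^ h : ℤ) ∣ s.2 := by
      refine IsCoprime.dvd_of_dvd_mul_left ?_ h2
      obtain ⟨j, hj⟩ := odd_cast hx
      rw [hj]
      exact IsCoprime.pow_left ⟨-j, 1, by ring⟩
    exact hf.not_dvd hr hrn hrh hnh (by exact_mod_cast h3)

/-- If a new triangle repeated an old class, its side `(a, b)` would be paired with an odd side `(x,
y)`, and `2 ^ h ∣ a + b` would give `2 ^ h ∣ y - x`. Two new triangles of one class lie below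
equivalent, hence equal, triangles. -/
theorem injOn_last (hn : 1 ≤ n) (hr : 2 ≤ r) (hrn : r * r ≤ 2 ^ n) (hrh : r ≤ 2 ^ h)
    (hnh : n ≤ 2 * h) (hhn : h ≤ n) (hS : Triangulates S (fanNodes r V t l))
    (hl : ∀ s ∈ l, IsFirstHit n r s (V s) (t s)) :
    Set.InjOn (cls (2 ^ n)) (fanNodes r V t l ∪ lastNodes h S) := by
  have hinj := injOn_fanNodes hn hr hrn hl
  have key : ∀ p ∈ lastNodes h S, cls (2 ^ n) p ∉ cls (2 ^ n) '' fanNodes r V t l := by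
    rintro ⟨a, b⟩ ⟨hp, ha, hb, hd⟩ hc
    obtain ⟨⟨x, y⟩, hq, hpq⟩ := hS.exists_paired hn hinj hp hc
    obtain ⟨-, hx0, hy0, -⟩ := hS.mem_sides.1 hq
    have hpq' := (isPaired_iff hn (hS.coprime_sides hp) (hS.coprime_sides hq) hx0 hy0).1 hpq
    simp only at ha hb hd hpq'
    have hx : Odd x := by grind
    have hy : Odd y := by grind
    refine not_dvd_sub_of_mem_sides hn hr hrn hrh hnh hhn hS hl hq hx hy ?_
    have h1 : (2 ^ h : ℤ) ∣ a * x + b * y := by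
      refine (pow_dvd_pow (2 : ℤ) hhn).trans ?_
      have := isPaired_iff_int.1 hpq
      exact_mod_cast this
    have h2 : (2 ^ h : ℤ) ∣ a + b := by exact_mod_cast hd
    have h3 : (2 ^ h : ℤ) ∣ b * (y - x) := by
      rw [show (b : ℤ) * (y - x) = (a * x + b * y) - (a + b) * x by ring]
      exact dvd_sub h1 (h2.mul_right _)
    refine IsCoprime.dvd_of_dvd_mul_left ?_ h3
    obtain ⟨j, hj⟩ := odd_cast hb
    rw [hj]
    exact IsCoprime.pow_left ⟨-j, 1, by ring⟩
  rintro p (hp | hp) q (hq | hq) hpq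
  · exact hinj hp hq hpq
  · exact absurd ⟨p, hp, hpq⟩ (key q hq)
  · exact absurd ⟨q, hq, hpq.symm⟩ (key p hp)
  · obtain ⟨hp, hp1, hp2, -⟩ := hp
    obtain ⟨hq, hq1, hq2, -⟩ := hq
    have e1 : p.1 % 2 = q.1 % 2 := by rw [Nat.odd_iff.1 hp1, Nat.odd_iff.1 hq1]
    have e2 : p.2 % 2 = q.2 % 2 := by rw [Nat.odd_iff.1 hp2, Nat.odd_iff.1 hq2]
    have hp' := hS.mem_sides.1 hp
    have hq' := hS.mem_sides.1 hq
    refine eq_of_parent_eq (hS.coprime_sides hp) (hinj hp'.2.2.2 hq'.2.2.2 ?_) e1 e2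
    exact cls_parent_congr (hS.coprime_sides hp) hp'.2.1 hp'.2.2.1 hq'.2.1 hq'.2.2.1 e1 e2 hpq

/-- A side of `F_r` is paired or starts a fan; a fan leads on to its next triangle or to its target.
Below a new triangle, rotation returns the same class because `2 ^ n ∣ (a + b) * (a + b)`. -/
theorem plusClosed_last (hn : 1 ≤ n) (hr : 2 ≤ r) (hnh : n ≤ 2 * h)
    (hl : ∀ s ∈ l, IsFirstHit n r s (V s) (t s))
    (hfree : ∀ s, IsFareySide r s → Odd s.1 → Even s.2 →
      (∀ t, IsFareySide r t → ¬ IsPaired (2 ^ n) s t) → s ∈ l) {T : List ℕ}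
    (hT : Triangulates T (fanNodes r V t l ∪ lastNodes h S)) :
    PlusClosed (2 ^ n) (cls (2 ^ n) '' (fanNodes r V t l ∪ lastNodes h S)) := by
  refine hT.plusClosed fun s hs hs1 hs2 => ?_
  obtain ⟨hI, hs10, hs20, hpar⟩ := hT.mem_sides.1 hs
  have hfan : ∀ s' ∈ l, ∀ k < V s', s ≠ fanNode s' (V s') (t s') k :=
    fun s' hs' k hk he => hI (Or.inl (Or.inr ⟨s', hs', k, hk, he⟩))
  rcases hpar with (hpar | ⟨s', hs', k, hk, hpar⟩) | hpar
  · have hside := isFareySide_of_parent_mem (by omega) hs10 hs20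
      (fun hc => hI (Or.inl (Or.inl hc))) hpar
    by_cases hf : ∀ t, IsFareySide r t → ¬ IsPaired (2 ^ n) s t
    · exfalso
      have hsl := hfree s hside hs1 hs2 hf
      refine hfan s hsl 0 (hl s hsl).pos ?_
      rw [fanNode, if_pos (by have := (hl s hsl).pos; omega)]
      simp
    · push Not at hf
      obtain ⟨p, hp, hsp⟩ := hf
      rw [isPaired_iff hn (hT.coprime_sides hs) hp.2.2.2.2.1 hp.1 hp.2.1] at hsp
      exact ⟨_, Or.inl (Or.inl hp.parent_mem), hsp.2.2.symm⟩
  · have hf := hl s' hs'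
    obtain ⟨hx, hy⟩ := hf.target_parity hn
    have hodd := hf.odd
    have heven := hf.even
    unfold fanNode at hpar
    split_ifs at hpar with hlt
    · rcases eq_of_parent hpar with he | he
      · exfalso
        rw [he] at hs2
        have h1 := odd_fan_nat hodd heven k
        simp only at hs2
        grind
      · have hcls : cls (2 ^ n) s = frac (2 ^ n) (s'.1 + ((k + 1 : ℕ) : ℤ) * s'.2) s'.2 := by
          rw [he, cls_even_right _ heven]
          apply frac_congr_of_eq _ rfl
          push_cast; ring
        rcases Nat.lt_or_ge (k + 1) (V s') with hlt | hge
        · exact ⟨_, Or.inl (Or.inr ⟨s', hs', k + 1, hlt, rfl⟩),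
            by rw [hcls, hf.cls_fanNode hn hlt]⟩
        · have hV : k + 1 = V s' := by omega
          rw [hV, hf.cls_last hn] at hcls
          exact ⟨_, Or.inl (Or.inl hf.target_side.parent_mem), hcls.symm⟩
    · exfalso
      have h1 := odd_fan_nat hy hx (V s' - 1 - k)
      rcases eq_of_parent hpar with he | he <;> rw [he] at hs1 hs2 <;> simp only at hs1 hs2
      · exact Nat.not_odd_iff_even.2 hx hs1
      · exact Nat.not_odd_iff_even.2 hs2 h1
  · obtain ⟨⟨a, b⟩, hab⟩ : ∃ p, p = parent s := ⟨_, rfl⟩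
    rw [← hab] at hpar
    have hpar' := hpar
    obtain ⟨-, ha, hb, hd⟩ := hpar'
    simp only at ha hb hd
    rcases eq_of_parent hab.symm with rfl | rfl
    · refine ⟨_, Or.inr hpar, ?_⟩
      simp only at hs2
      rw [cls_odd_odd _ ha hb, cls_even_right _ hs2, frac_eq_iff (odd_cast hb).neg (odd_cast ha)]
      have h1 : (2 ^ n : ℕ) ∣ (a + b) * (a + b) := by
        refine (pow_dvd_pow 2 (show n ≤ h + h by omega)).trans ?_
        rw [pow_add]
        exact mul_dvd_mul hd hd
      have h2 : (2 ^ n : ℤ) ∣ (a + b) * (a + b) := by exact_mod_cast h1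
      obtain ⟨m, hm⟩ := h2
      refine ⟨-m, ?_⟩
      push_cast
      linear_combination -hm
    · exact absurd hb (Nat.not_odd_iff_even.2 hs2)

/-- Splitting an odd side yields sides with an even entry, so no new candidates arise. -/
theorem not_dvd_last {T : List ℕ} (hS : Triangulates S (fanNodes r V t l))
    (hT : Triangulates T (fanNodes r V t l ∪ lastNodes h S)) {s : ℕ × ℕ} (hs : s ∈ sides T)
    (hs1 : Odd s.1) (hs2 : Odd s.2) : ¬ 2 ^ h ∣ s.1 + s.2 := by
  intro hd
  obtain ⟨hI, hs10, hs20, hpar⟩ := hT.mem_sides.1 hs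
  rcases hpar with hpar | ⟨-, h1, h2, -⟩
  · have hsS : s ∈ sides S := hS.mem_sides.2 ⟨fun hc => hI (Or.inl hc), hs10, hs20, hpar⟩
    exact hI (Or.inr ⟨hsS, hs1, hs2, hd⟩)
  · rcases eq_of_parent (Prod.mk.eta (p := parent s)).symm with he | he
    · rw [he] at hs2
      exact Nat.not_odd_iff_even.2 (h1.add_odd h2) hs2
    · rw [he] at hs1
      exact Nat.not_odd_iff_even.2 (h1.add_odd h2) hs1

/-- For the final insertions, the sum is a multiple of `2 ^ h` below `2 ^ (n - 1) + 2 ^ h`, hence at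
most `2 ^ (n - 1)`. -/
theorem add_le_last (hn : 2 ≤ n) (hr : 2 ≤ r) (hrn : r * r ≤ 2 ^ n) (hrh : r ≤ 2 ^ h)
    (hhn : h ≤ n - 1) (hS : Triangulates S (fanNodes r V t l))
    (hl : ∀ s ∈ l, IsFirstHit n r s (V s) (t s)) :
    ∀ p ∈ fanNodes r V t l ∪ lastNodes h S, p.1 + p.2 ≤ 2 ^ (n - 1) := by
  have hpow : 2 ^ n = 2 * 2 ^ (n - 1) := by rw [← pow_succ', Nat.sub_add_cancel (by omega)]
  have hr' : r ≤ 2 ^ (n - 1) := by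
    have : 2 * r ≤ r * r := Nat.mul_le_mul_right _ hr
    omega
  rintro p (((rfl | hp) | ⟨s, hs, k, hk, rfl⟩) | hp)
  · exact Nat.one_le_two_pow
  · exact hp.2.2.2.trans hr'
  · exact (hl s hs).fanNode_add_le hn hr hrn hk
  · obtain ⟨hp, h1, h2, hd⟩ := hp
    have hlt : p.1 + p.2 < 2 ^ (n - 1) + 2 ^ h := by
      obtain ⟨hI, hp10, hp20, hpar⟩ := hS.mem_sides.1 hp
      rcases hpar with hpar | ⟨s, hs, k, hk, hpar⟩
      · obtain ⟨-, -, h3, h4, hco, -⟩ := isFareySide_of_parent_mem (by omega) hp10 hp20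
          (fun hc => hI (Or.inl hc)) hpar
        have hne : p.1 ≠ p.2 := by
          intro hc
          rw [hc, Nat.coprime_self] at hco
          have : p ∈ fareyNodes r := Or.inr ⟨hp10, hp20, by rw [hc, hco]; simp, by omega⟩
          exact hI (Or.inl this)
        omega
      · have := (hl s hs).child_fanNode_add_lt hn hr hrn hk hpar h1 h2
        omega
    obtain ⟨c, hc⟩ := hd
    obtain ⟨e, he⟩ := pow_dvd_pow 2 hhn
    rw [hc, he] at hlt ⊢
    rw [← Nat.mul_succ] at hlt
    exact Nat.mul_le_mul_left _ (Nat.lt_succ_iff.1 (Nat.lt_of_mul_lt_mul_left hlt))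

end last

/-! ### Assembly of the theorem -/

theorem mem_freeEvenSides {n : ℕ} (hn : 2 ≤ n) {s : ℕ × ℕ} : s ∈ freeEvenSides n ↔
    IsFareySide (Nat.sqrt (2 ^ n)) s ∧ Odd s.1 ∧ Even s.2 ∧
      ∀ t, IsFareySide (Nat.sqrt (2 ^ n)) t → ¬ IsPaired (2 ^ n) s t := by
  have hr : 1 ≤ Nat.sqrt (2 ^ n) := Nat.sqrt_pos.2 (by positivity)
  unfold freeEvenSides
  rw [List.mem_filter, decide_eq_true_eq, mem_sides_fareyF hr, IsFree]
  simp only [mem_sides_fareyF hr]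
  constructor
  · rintro ⟨h1, h2, h3, -, h4⟩
    exact ⟨h1, h2, h3, h4⟩
  · rintro ⟨h1, h2, h3, h4⟩
    exact ⟨h1, h2, h3, not_isElliptic hn h1.2.2.2.2.1, h4⟩

end DKLT

theorem theorem9p1 (n : ℕ) (hn : 2 ≤ n) (order : List (ℕ × ℕ))
    (horder : order.Perm (DKLT.freeEvenSides n)) :
    ∃ T : List ℕ, DKLT.algorithm n order = some T ∧
      DKLT.IsFareySequenceOf (2 ^ n) T ∧
      (∀ e ∈ T, e ≤ 2 ^ (n - 1)) ∧
      T.count (2 ^ (n - 1)) = 1 ∧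
      (∀ F : List ℕ, DKLT.IsFareySequenceOf (2 ^ n) F → ∃ e ∈ F, 2 ^ (n - 1) ≤ e) := by
  have hr : 2 ≤ Nat.sqrt (2 ^ n) := by
    rw [Nat.le_sqrt]; exact (Nat.pow_le_pow_right (by norm_num) hn : 2 ^ 2 ≤ 2 ^ n)
  have hrn : Nat.sqrt (2 ^ n) * Nat.sqrt (2 ^ n) ≤ 2 ^ n := Nat.sqrt_le _
  have hrh : Nat.sqrt (2 ^ n) ≤ 2 ^ ((n + 1) / 2) := by
    rw [← Nat.lt_succ_iff, Nat.sqrt_lt]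
    calc 2 ^ n ≤ 2 ^ ((n + 1) / 2) * 2 ^ ((n + 1) / 2) := by
          rw [← pow_add]; exact Nat.pow_le_pow_right (by norm_num) (by omega)
      _ < _ := Nat.mul_self_lt_mul_self (Nat.lt_succ_self _)
  have hmem : ∀ s, s ∈ order ↔ DKLT.IsFareySide (Nat.sqrt (2 ^ n)) s ∧ Odd s.1 ∧ Even s.2 ∧
      ∀ t, DKLT.IsFareySide (Nat.sqrt (2 ^ n)) t → ¬ DKLT.IsPaired (2 ^ n) s t :=
    fun s => horder.mem_iff.trans (DKLT.mem_freeEvenSides hn)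
  have hFarey := DKLT.fareyF_triangulates (Nat.sqrt (2 ^ n))
  have hnd : order.Nodup := horder.nodup_iff.2 (hFarey.nodup_sides.filter _)
  -- Outside `order` the values are arbitrary, which makes `V` and `t` total functions.
  have hex : ∀ s, ∃ v t, s ∈ order →
      DKLT.chainSearch (2 ^ n) (DKLT.fareyF (Nat.sqrt (2 ^ n))) s = some (v, t) ∧
        DKLT.IsFirstHit n (Nat.sqrt (2 ^ n)) s v t := by
    intro s
    by_cases hs : s ∈ order
    · obtain ⟨h1, h2, h3, h4⟩ := (hmem s).1 hs
      obtain ⟨v, t, h5⟩ := DKLT.exists_chainSearch hn hr hrn h1 h2 h3 h4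
      exact ⟨v, t, fun _ => h5⟩
    · exact ⟨0, s, fun hc => absurd hc hs⟩
  choose V t hVt using hex
  obtain ⟨S, hfold, hS, href⟩ := DKLT.foldlM_insertChain (V := V) (t := t) (by omega) hr hrn order []
    (by simpa using hnd) (by simpa using hVt) (DKLT.fareyF (Nat.sqrt (2 ^ n)))
    (by simpa [DKLT.fanNodes] using hFarey) Relation.ReflTransGen.refl
  rw [List.nil_append] at hS
  have hl : ∀ s ∈ order, DKLT.IsFirstHit n (Nat.sqrt (2 ^ n)) s (V s) (t s) :=
    fun s hs => (hVt s hs).2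
  obtain ⟨hT, href'⟩ := hS.insertWhere fun a b => Odd a ∧ Odd b ∧ 2 ^ ((n + 1) / 2) ∣ a + b
  have hinj := DKLT.injOn_last (by omega) hr hrn hrh (by omega) (by omega) hS hl
  have hseq := hT.isFareySequenceOf hn (href.trans href') hinj
    (fun p hp => Or.inl (Or.inl hp))
    (DKLT.plusClosed_last (by omega) hr (by omega) hl
      (fun s h1 h2 h3 h4 => (hmem s).2 ⟨h1, h2, h3, h4⟩) hT)
    (fun s => DKLT.not_dvd_last hS hT)
  have hle := DKLT.add_le_last hn hr hrn hrh (by omega) hS hl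
  have hle' : ∀ e ∈ DKLT.insertWhere
      (fun a b => Odd a ∧ Odd b ∧ 2 ^ ((n + 1) / 2) ∣ a + b) S, e ≤ 2 ^ (n - 1) := by
    intro e he
    obtain ⟨p, hp, rfl⟩ := (hT.mem_iff e).1 he
    exact hle p hp
  refine ⟨_, ?_, hseq, hle', hT.count_half hn hseq hinj hle',
    fun F hF => hF.exists_large hn⟩
  rw [DKLT.algorithm, hfold]
  rfl
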